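/- Let $\mathbb D$ be the open unit disk, $m$ the rotation-invariant probability measure on $\partial\mathbb D$, and $A$ the area measure on $\mathbb C$ normalized so that $A(\mathbb D)=1$. For $p\in[1,\infty[$ and $\alpha>-1$ let $H^p$ and $A^p_\alpha$ be the spaces of analytic functions $f$ on $\mathbb D$ for which, respectively, $$\|f\|_{H^p}=\lim_{r\to1^-}\Big(\int_{\partial\mathbb D}|f(rz)|^p\,dm(z)\Big)^{1/p}=\sup_{0\le r<1}\Big(\int_{\partial\mathbb D}|f(rz)|^p\,dm(z)\Big)^{1/p},$$ $$\|f\|_{A^p_\alpha}=\Big((\alpha+1)\int_{\mathbb D}|f(z)|^p(1-|z|^2)^\alpha\,dA(z)\Big)^{1/p}$$ is finite, and let $H^\infty$ be the space of bounded analytic functions on $\mathbb D$ with $\|g\|_\infty=\sup_{z\in\mathbb D}|g(z)|$. For $g\in H^\infty$ let $M_g f=gf$ be the multiplication operator. A family $\{S_t:t\in\,]0,1[\}$ of bounded linear operators on a Banach space $X$ is said to satisfy $W(X)$ if $t\mapsto S_tf$ is continuous on $]0,1[$ for every $f\in X$, and $\int_0^1\|S_t\|\,dt<\infty$. Let $X=H^p$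 or $X=A^p_\alpha$, where $p\in[1,\infty[$ and $\alpha>-1$, and let $g_t\in H^\infty$ for $t\in\,]0,1[$. The family $\{M_{g_t}:t\in\,]0,1[\}$ satisfies $W(X)$ if and only if 1. for every $t_0\in\,]0,1[$, $\lim_{t\to t_0}\|g_t-g_{t_0}\|_X=0$; 2. for every compact set $K\subset\,]0,1[$, $\sup_{t\in K}\|g_t\|_\infty<\infty$; and 3. $\int_0^1\|g_t\|_\infty\,dt<\infty$. Moreover, for the weaker, pointwise form of $W(X)$, in which $t\mapsto M_{g_t}f$ is continuous on $]0,1[$ and $\int_0^1\|M_{g_t}f\|_X\,dt<\infty$ for every $f\in X$, conditions 1, 2 and 3 together are sufficient, and conditions 1 and 2 are necessary. -/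

import Mathlib

open MeasureTheory Set Filter Topology
open scoped ENNReal

noncomputable section

/-- The open unit disk of the complex plane. -/
abbrev Disc : Type := Metric.ball (0 : ℂ) 1

namespace Disc

open Classical in
/-- A function on the disk, viewed as a function on `ℂ` (with value `0` off the disk). -/
def discExt (f : Disc → ℂ) : ℂ → ℂ :=
  fun z => if h : z ∈ Metric.ball (0 : ℂ) 1 then f ⟨z, h⟩ else 0

theorem discExt_coe (f : Disc → ℂ) (z : Disc) : discExt f z = f z := by
  simp only [discExt, dif_pos z.2]

theorem discExt_zero : discExt 0 = 0 := by
  funext z; simp [discExt]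

theorem discExt_add (f g : Disc → ℂ) : discExt (f + g) = discExt f + discExt g := by
  funext z
  by_cases h : z ∈ Metric.ball (0 : ℂ) 1 <;>
    simp only [discExt, Pi.add_apply, h, dite_true, dite_false, add_zero]

theorem discExt_smul (c : ℂ) (f : Disc → ℂ) : discExt (c • f) = c • discExt f := by
  funext z
  by_cases h : z ∈ Metric.ball (0 : ℂ) 1 <;>
    simp only [discExt, Pi.smul_apply, h, dite_true, dite_false, smul_zero]

theorem discExt_mul (f g : Disc → ℂ) : discExt (f * g) = discExt f * discExt g := by
  funext z
  by_cases h : z ∈ Metric.ball (0 : ℂ) 1 <;>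
    simp only [discExt, Pi.mul_apply, h, dite_true, dite_false, mul_zero]

/-- Analytic functions on the open unit disk. -/
def IsHolomorphic (f : Disc → ℂ) : Prop :=
  DifferentiableOn ℂ (discExt f) (Metric.ball (0 : ℂ) 1)

theorem IsHolomorphic.zero : IsHolomorphic 0 := by
  rw [IsHolomorphic, discExt_zero]; exact differentiableOn_const 0

theorem IsHolomorphic.add {f g : Disc → ℂ} (hf : IsHolomorphic f) (hg : IsHolomorphic g) :
    IsHolomorphic (f + g) := by
  rw [IsHolomorphic, discExt_add]; exact DifferentiableOn.add hf hg

theorem IsHolomorphic.smul (c : ℂ) {f : Disc → ℂ} (hf : IsHolomorphic f) :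
    IsHolomorphic (c • f) := by
  rw [IsHolomorphic, discExt_smul]; exact DifferentiableOn.const_smul hf c

theorem IsHolomorphic.mul {f g : Disc → ℂ} (hf : IsHolomorphic f) (hg : IsHolomorphic g) :
    IsHolomorphic (f * g) := by
  rw [IsHolomorphic, discExt_mul]; exact DifferentiableOn.mul hf hg

end Disc

open Disc

/-! ### Bounded analytic functions -/

/-- `H^∞`: the bounded analytic functions on the disk. -/
structure HInfty where
  toFun : Disc → ℂ
  holomorphic : IsHolomorphic toFun
  bounded : BddAbove (range fun z => ‖toFun z‖)

/-- `‖g‖_∞ = sup_{z ∈ 𝔻} |g(z)|`. -/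
def HInfty.supNorm (g : HInfty) : ℝ := ⨆ z : Disc, ‖g.toFun z‖

theorem HInfty.norm_le (g : HInfty) (z : Disc) : ‖g.toFun z‖ ≤ g.supNorm :=
  le_ciSup g.bounded z

theorem HInfty.supNorm_nonneg (g : HInfty) : 0 ≤ g.supNorm :=
  Real.iSup_nonneg fun _ => norm_nonneg _

theorem HInfty.norm_discExt_mul_le (g : HInfty) (f : Disc → ℂ) (z : ℂ) :
    ‖discExt (g.toFun * f) z‖ ≤ g.supNorm * ‖discExt f z‖ := by
  rw [discExt_mul, Pi.mul_apply, norm_mul]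
  refine mul_le_mul_of_nonneg_right ?_ (norm_nonneg _)
  by_cases h : z ∈ Metric.ball (0 : ℂ) 1
  · simpa only [discExt, dif_pos h] using g.norm_le ⟨z, h⟩
  · simpa only [discExt, dif_neg h, norm_zero] using g.supNorm_nonneg

/-! ### Hardy spaces -/

/-- The rotation-invariant probability measure on the circle, in the angular coordinate. -/
def angleMeasure : Measure ℝ :=
  ENNReal.ofReal (2 * Real.pi)⁻¹ • volume.restrict (Ioc 0 (2 * Real.pi))

/-- The integral mean `(∫ |f(r z)|^p dm(z))^{1/p}` over the circle of radius `r`. -/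
def circleMean (p : ℝ≥0∞) (r : ℝ) (f : Disc → ℂ) : ℝ≥0∞ :=
  eLpNorm (fun θ => discExt f (circleMap 0 r θ)) p angleMeasure

/-- The `H^p` norm, with value `∞` outside `H^p`. For an analytic `f` the integral means are
nondecreasing in `r`, so that the supremum is the limit as `r → 1`. -/
def hardyENorm (p : ℝ≥0∞) (f : Disc → ℂ) : ℝ≥0∞ :=
  ⨆ r ∈ Ico (0 : ℝ) 1, circleMean p r f

theorem continuous_circle {f : Disc → ℂ} (hf : IsHolomorphic f) {r : ℝ} (hr : r ∈ Ico (0 : ℝ) 1) :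
    Continuous fun θ => discExt f (circleMap 0 r θ) := by
  refine ContinuousOn.comp_continuous hf.continuousOn (continuous_circleMap 0 r) fun θ => ?_
  rw [mem_ball_zero_iff, norm_circleMap_zero, abs_of_nonneg hr.1]
  exact hr.2

theorem hardyENorm_zero (p : ℝ≥0∞) : hardyENorm p 0 = 0 := by
  simp [hardyENorm, circleMean, discExt_zero]

theorem hardyENorm_add_le {p : ℝ≥0∞} (hp : 1 ≤ p) {f g : Disc → ℂ} (hf : IsHolomorphic f)
    (hg : IsHolomorphic g) : hardyENorm p (f + g) ≤ hardyENorm p f + hardyENorm p g := by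
  refine iSup₂_le fun r hr => ?_
  refine le_trans ?_ (add_le_add (le_iSup₂ (f := fun r _ => circleMean p r f) r hr)
    (le_iSup₂ (f := fun r _ => circleMean p r g) r hr))
  simp only [circleMean, discExt_add]
  exact eLpNorm_add_le (continuous_circle hf hr).aestronglyMeasurable
    (continuous_circle hg hr).aestronglyMeasurable hp

theorem hardyENorm_smul (p : ℝ≥0∞) (c : ℂ) (f : Disc → ℂ) :
    hardyENorm p (c • f) = ‖c‖ₑ * hardyENorm p f := by
  simp only [hardyENorm, ENNReal.mul_iSup]
  refine iSup_congr fun r => iSup_congr fun _ => ?_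
  simp only [circleMean, discExt_smul]
  exact eLpNorm_const_smul c _ p angleMeasure

theorem hardyENorm_mul_le (p : ℝ≥0∞) (g : HInfty) (f : Disc → ℂ) :
    hardyENorm p (g.toFun * f) ≤ ENNReal.ofReal g.supNorm * hardyENorm p f := by
  refine iSup₂_le fun r hr => ?_
  refine le_trans ?_ (mul_le_mul_right (le_iSup₂ (f := fun r _ => circleMean p r f) r hr) _)
  exact eLpNorm_le_mul_eLpNorm_of_ae_le_mul (.of_forall fun θ => g.norm_discExt_mul_le f _) p

theorem eq_zero_of_hardyENorm {p : ℝ≥0∞} (hp : 1 ≤ p) {f : Disc → ℂ} (hf : IsHolomorphic f)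
    (h : hardyENorm p f = 0) : f = 0 := by
  funext z
  have hr : ‖(z : ℂ)‖ ∈ Ico (0 : ℝ) 1 := ⟨norm_nonneg _, mem_ball_zero_iff.1 z.2⟩
  have hc : circleMean p ‖(z : ℂ)‖ f = 0 :=
    le_antisymm ((le_iSup₂ (f := fun r _ => circleMean p r f) _ hr).trans h.le) zero_le
  have hcont := continuous_circle hf hr
  have h0 := (eLpNorm_eq_zero_iff hcont.aestronglyMeasurable (by positivity)).1 hc
  have hpi := Real.two_pi_pos
  rw [angleMeasure, Filter.EventuallyEq, Measure.ae_ennreal_smul_measure_iff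
    (by simpa using hpi)] at h0
  have h1 := Measure.eqOn_Ioc_of_ae_eq volume h0 hcont.continuousOn
    continuousOn_const
  obtain ⟨θ, hθ, hθz⟩ : ∃ θ ∈ Ioc 0 (2 * Real.pi), circleMap 0 ‖(z : ℂ)‖ θ = z := by
    have : (z : ℂ) ∈ circleMap 0 ‖(z : ℂ)‖ '' Ioc 0 (2 * Real.pi) := by
      rw [image_circleMap_Ioc]; simp
    exact this
  have := h1 hθ
  simp only [hθz, discExt_coe] at this
  exact this

/-- `H^p` as a space of functions. -/
def hardySubmodule (p : ℝ≥0∞) [hp : Fact (1 ≤ p)] : Submodule ℂ (Disc → ℂ) where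
  carrier := {f | IsHolomorphic f ∧ hardyENorm p f < ∞}
  zero_mem' := ⟨.zero, by simp [hardyENorm_zero]⟩
  add_mem' hf hg := ⟨hf.1.add hg.1,
    (hardyENorm_add_le hp.out hf.1 hg.1).trans_lt (ENNReal.add_lt_top.2 ⟨hf.2, hg.2⟩)⟩
  smul_mem' c f hf := ⟨hf.1.smul c, by
    rw [hardyENorm_smul]; exact ENNReal.mul_lt_top enorm_lt_top hf.2⟩

/-- The Hardy space `H^p`. -/
def Hardy (p : ℝ≥0∞) [Fact (1 ≤ p)] : Type := hardySubmodule p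

namespace Hardy

variable {p : ℝ≥0∞} [hp : Fact (1 ≤ p)]

instance : AddCommGroup (Hardy p) := inferInstanceAs (AddCommGroup (hardySubmodule p))
instance : Module ℂ (Hardy p) := inferInstanceAs (Module ℂ (hardySubmodule p))
instance : Norm (Hardy p) := ⟨fun f => (hardyENorm p f.1).toReal⟩

theorem core : NormedSpace.Core ℂ (Hardy p) where
  norm_nonneg _ := ENNReal.toReal_nonneg
  norm_smul c f := by
    change (hardyENorm p (c • f.1)).toReal = ‖c‖ * (hardyENorm p f.1).toReal
    rw [hardyENorm_smul, ENNReal.toReal_mul, toReal_enorm]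
  norm_triangle f g := by
    change (hardyENorm p (f.1 + g.1)).toReal ≤ _
    exact (ENNReal.toReal_mono (ENNReal.add_lt_top.2 ⟨f.2.2, g.2.2⟩).ne
      (hardyENorm_add_le hp.out f.2.1 g.2.1)).trans
        (ENNReal.toReal_add f.2.2.ne g.2.2.ne).le
  norm_eq_zero_iff f := by
    change (hardyENorm p f.1).toReal = 0 ↔ _
    rw [ENNReal.toReal_eq_zero_iff]
    constructor
    · rintro (h | h)
      · exact Subtype.ext (eq_zero_of_hardyENorm hp.out f.2.1 h)
      · exact absurd h f.2.2.ne
    · rintro rfl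
      exact Or.inl (hardyENorm_zero p)

instance : NormedAddCommGroup (Hardy p) := NormedAddCommGroup.ofCore core
instance : NormedSpace ℂ (Hardy p) := NormedSpace.ofCore core

/-- The multiplication operator `M_g : H^p → H^p`, `f ↦ g f`. -/
def mulOp (p : ℝ≥0∞) [Fact (1 ≤ p)] (g : HInfty) : Hardy p →L[ℂ] Hardy p :=
  LinearMap.mkContinuous
    { toFun := fun f => ⟨g.toFun * f.1, g.holomorphic.mul f.2.1,
        (hardyENorm_mul_le p g f.1).trans_lt (ENNReal.mul_lt_top ENNReal.ofReal_lt_top f.2.2)⟩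
      map_add' := fun f₁ f₂ => Subtype.ext (mul_add g.toFun f₁.1 f₂.1)
      map_smul' := fun c f => Subtype.ext (mul_smul_comm c g.toFun f.1) }
    g.supNorm
    (fun f => (ENNReal.toReal_mono
      (ENNReal.mul_lt_top ENNReal.ofReal_lt_top f.2.2).ne (hardyENorm_mul_le p g f.1)).trans_eq (by
        rw [ENNReal.toReal_mul, ENNReal.toReal_ofReal g.supNorm_nonneg]; rfl))

end Hardy

/-! ### Weighted Bergman spaces -/

/-- The measure `dA_α(z) = (α + 1) (1 - |z|²)^α dA(z)` on the disk, where `A` is area measure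
divided by `π`; it is a probability measure for `α > -1`. -/
def bergmanMeasure (α : ℝ) : Measure ℂ :=
  (volume.restrict (Metric.ball (0 : ℂ) 1)).withDensity
    fun z => ENNReal.ofReal ((α + 1) / Real.pi * (1 - ‖z‖ ^ 2) ^ α)

/-- The `A^p_α` norm `(∫ |f|^p dA_α)^{1/p}`, with value `∞` outside `A^p_α`. -/
def bergmanENorm (p : ℝ≥0∞) (α : ℝ) (f : Disc → ℂ) : ℝ≥0∞ :=
  eLpNorm (discExt f) p (bergmanMeasure α)

theorem aestronglyMeasurable_bergman (α : ℝ) {f : Disc → ℂ} (hf : IsHolomorphic f) :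
    AEStronglyMeasurable (discExt f) (bergmanMeasure α) :=
  (hf.continuousOn.aestronglyMeasurable Metric.isOpen_ball.measurableSet).mono_ac
    (withDensity_absolutelyContinuous _ _)

theorem bergmanENorm_zero (p : ℝ≥0∞) (α : ℝ) : bergmanENorm p α 0 = 0 := by
  rw [bergmanENorm, discExt_zero, eLpNorm_zero]

theorem bergmanENorm_add_le {p : ℝ≥0∞} (hp : 1 ≤ p) (α : ℝ) {f g : Disc → ℂ}
    (hf : IsHolomorphic f) (hg : IsHolomorphic g) :
    bergmanENorm p α (f + g) ≤ bergmanENorm p α f + bergmanENorm p α g := by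
  rw [bergmanENorm, discExt_add]
  exact eLpNorm_add_le (aestronglyMeasurable_bergman α hf) (aestronglyMeasurable_bergman α hg) hp

theorem bergmanENorm_smul (p : ℝ≥0∞) (α : ℝ) (c : ℂ) (f : Disc → ℂ) :
    bergmanENorm p α (c • f) = ‖c‖ₑ * bergmanENorm p α f := by
  rw [bergmanENorm, discExt_smul]
  exact eLpNorm_const_smul c _ p _

theorem bergmanENorm_mul_le (p : ℝ≥0∞) (α : ℝ) (g : HInfty) (f : Disc → ℂ) :
    bergmanENorm p α (g.toFun * f) ≤ ENNReal.ofReal g.supNorm * bergmanENorm p α f :=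
  eLpNorm_le_mul_eLpNorm_of_ae_le_mul (.of_forall fun z => g.norm_discExt_mul_le f z) p

theorem eq_zero_of_bergmanENorm {p : ℝ≥0∞} (hp : 1 ≤ p) {α : ℝ} (hα : -1 < α) {f : Disc → ℂ}
    (hf : IsHolomorphic f) (h : bergmanENorm p α f = 0) : f = 0 := by
  have h0 := (eLpNorm_eq_zero_iff (aestronglyMeasurable_bergman α hf) (by positivity)).1 h
  have hac : volume.restrict (Metric.ball (0 : ℂ) 1) ≪ bergmanMeasure α := by
    refine withDensity_absolutelyContinuous' ?_ ?_
    · exact Measurable.aemeasurable (by fun_prop)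
    · filter_upwards [ae_restrict_mem Metric.isOpen_ball.measurableSet] with z hz
      have hz1 : ‖z‖ < 1 := by simpa using hz
      have h1 : 0 < 1 - ‖z‖ ^ 2 := by nlinarith [norm_nonneg z]
      have h2 : 0 < α + 1 := by linarith
      have : 0 < (α + 1) / Real.pi * (1 - ‖z‖ ^ 2) ^ α :=
        mul_pos (div_pos h2 Real.pi_pos) (Real.rpow_pos_of_pos h1 α)
      simpa using this
  have h1 := Measure.eqOn_open_of_ae_eq (hac.ae_eq h0) Metric.isOpen_ball hf.continuousOn
    continuousOn_const
  funext z
  have := h1 z.2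
  rwa [discExt_coe] at this

/-- `A^p_α` as a space of functions. -/
def bergmanSubmodule (p : ℝ≥0∞) [hp : Fact (1 ≤ p)] (α : ℝ) : Submodule ℂ (Disc → ℂ) where
  carrier := {f | IsHolomorphic f ∧ bergmanENorm p α f < ∞}
  zero_mem' := ⟨.zero, by simp [bergmanENorm_zero]⟩
  add_mem' hf hg := ⟨hf.1.add hg.1,
    (bergmanENorm_add_le hp.out α hf.1 hg.1).trans_lt (ENNReal.add_lt_top.2 ⟨hf.2, hg.2⟩)⟩
  smul_mem' c f hf := ⟨hf.1.smul c, by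
    rw [bergmanENorm_smul]; exact ENNReal.mul_lt_top enorm_lt_top hf.2⟩

/-- The weighted Bergman space `A^p_α`. -/
def Bergman (p : ℝ≥0∞) [Fact (1 ≤ p)] (α : ℝ) : Type := bergmanSubmodule p α

namespace Bergman

variable {p : ℝ≥0∞} [hp : Fact (1 ≤ p)] {α : ℝ} [hα : Fact (-1 < α)]

instance : AddCommGroup (Bergman p α) := inferInstanceAs (AddCommGroup (bergmanSubmodule p α))
instance : Module ℂ (Bergman p α) := inferInstanceAs (Module ℂ (bergmanSubmodule p α))
instance : Norm (Bergman p α) := ⟨fun f => (bergmanENorm p α f.1).toReal⟩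

theorem core : NormedSpace.Core ℂ (Bergman p α) where
  norm_nonneg _ := ENNReal.toReal_nonneg
  norm_smul c f := by
    change (bergmanENorm p α (c • f.1)).toReal = ‖c‖ * (bergmanENorm p α f.1).toReal
    rw [bergmanENorm_smul, ENNReal.toReal_mul, toReal_enorm]
  norm_triangle f g := by
    change (bergmanENorm p α (f.1 + g.1)).toReal ≤ _
    exact (ENNReal.toReal_mono (ENNReal.add_lt_top.2 ⟨f.2.2, g.2.2⟩).ne
      (bergmanENorm_add_le hp.out α f.2.1 g.2.1)).trans
        (ENNReal.toReal_add f.2.2.ne g.2.2.ne).le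
  norm_eq_zero_iff f := by
    change (bergmanENorm p α f.1).toReal = 0 ↔ _
    rw [ENNReal.toReal_eq_zero_iff]
    constructor
    · rintro (h | h)
      · exact Subtype.ext (eq_zero_of_bergmanENorm hp.out hα.out f.2.1 h)
      · exact absurd h f.2.2.ne
    · rintro rfl
      exact Or.inl (bergmanENorm_zero p α)

instance : NormedAddCommGroup (Bergman p α) := NormedAddCommGroup.ofCore core
instance : NormedSpace ℂ (Bergman p α) := NormedSpace.ofCore core

/-- The multiplication operator `M_g : A^p_α → A^p_α`, `f ↦ g f`. -/
def mulOp (p : ℝ≥0∞) [Fact (1 ≤ p)] (α : ℝ) [Fact (-1 < α)] (g : HInfty) :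
    Bergman p α →L[ℂ] Bergman p α :=
  LinearMap.mkContinuous
    { toFun := fun f => ⟨g.toFun * f.1, g.holomorphic.mul f.2.1,
        (bergmanENorm_mul_le p α g f.1).trans_lt (ENNReal.mul_lt_top ENNReal.ofReal_lt_top f.2.2)⟩
      map_add' := fun f₁ f₂ => Subtype.ext (mul_add g.toFun f₁.1 f₂.1)
      map_smul' := fun c f => Subtype.ext (mul_smul_comm c g.toFun f.1) }
    g.supNorm
    (fun f => (ENNReal.toReal_mono
      (ENNReal.mul_lt_top ENNReal.ofReal_lt_top f.2.2).ne (bergmanENorm_mul_le p α g f.1)).trans_eq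
        (by rw [ENNReal.toReal_mul, ENNReal.toReal_ofReal g.supNorm_nonneg]; rfl))

end Bergman

/-! ### Families of operators indexed by the open unit interval -/

/-- The condition `W(X)` on `{S_t : 0 < t < 1}`: `t ↦ S_t f` is continuous for every `f`, and the
operator norms are integrable. -/
def SatisfiesW {X : Type*} [NormedAddCommGroup X] [NormedSpace ℂ X] (S : ℝ → X →L[ℂ] X) : Prop :=
  (∀ f : X, ContinuousOn (fun t => S t f) (Ioo 0 1)) ∧
    IntegrableOn (fun t => ‖S t‖) (Ioo 0 1)

/-- The weaker condition in which `t ↦ ‖S_t f‖` is only required to be integrable for each `f`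
separately. -/
def SatisfiesPointwiseW {X : Type*} [NormedAddCommGroup X] [NormedSpace ℂ X] (S : ℝ → X →L[ℂ] X) :
    Prop :=
  ∀ f : X, ContinuousOn (fun t => S t f) (Ioo 0 1) ∧ IntegrableOn (fun t => ‖S t f‖) (Ioo 0 1)

/-- `lim_{t → t₀} N(g_t - g_{t₀}) = 0` for every `t₀ ∈ ]0,1[`, for a norm `N` (possibly infinite)
of functions on the disk. -/
def SymbolsContinuous (N : (Disc → ℂ) → ℝ≥0∞) (g : ℝ → HInfty) : Prop :=
  ∀ t₀ ∈ Ioo (0 : ℝ) 1, Tendsto (fun t => N ((g t).toFun - (g t₀).toFun)) (𝓝 t₀) (𝓝 0)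

/-- `sup_{t ∈ K} ‖g_t‖_∞ < ∞` for every compact `K ⊆ ]0,1[`. -/
def SymbolsLocallyBounded (g : ℝ → HInfty) : Prop :=
  ∀ K : Set ℝ, IsCompact K → K ⊆ Ioo 0 1 → BddAbove ((fun t => (g t).supNorm) '' K)

/-- `∫_0^1 ‖g_t‖_∞ dt < ∞`. -/
def SymbolsIntegrable (g : ℝ → HInfty) : Prop :=
  IntegrableOn (fun t => (g t).supNorm) (Ioo 0 1)

end

open Disc

/-! ### Normed spaces of analytic functions on the disk -/

/-! Both scales of spaces are instances of `IsAnalyticSpace`, and the equivalence is proved once at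
that level. Point evaluations are nonzero functionals and eigenvectors of the adjoint of `M g`, so
the operator norm is exactly the sup norm (`norm_mulOp`); condition 3 is therefore the norm
integrability in W(X). Testing strong continuity on the constant 1 gives condition 1, and
Banach-Steinhaus on a compact set gives condition 2, once `X` is known to be complete.

For the converse, the differences `G t` of symbols are bounded near `t₀` and tend to 0 in norm, and
one needs `G t * f → 0` for every `f` in `X`; this is the field `mul_tendsto`. In Bergman spaces it
is dominated convergence on the disk, since norm convergence implies pointwise convergence.

In Hardy spaces the estimate must be uniform over all circles of radius `r < 1`. No boundary values
are used. Instead `|f|^p ≤ |F|^2` with `F = ∑ c k * z ^ k` and square summable `c`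
(`exists_series_majorant`). Cutting the series at `n` leaves a bounded polynomial, which is
multiplied by the small `|G t|^p`, and a tail of small `ℓ²` norm, which is multiplied by the bounded
`|G t|^p` (`hardyENorm_mul_rpow_le`). The majorant is the limit of functions `exp (p H / 2)`, where
`H` is entire and its real part approximates the logarithm of a dilate of `|f| + 1` on the circle,
up to a constant. -/

theorem Disc.isHolomorphic_one : IsHolomorphic 1 := by
  refine (differentiableOn_const (1 : ℂ)).congr fun z hz => ?_
  exact discExt_coe 1 ⟨z, hz⟩

theorem Disc.IsHolomorphic.sub {f g : Disc → ℂ} (hf : IsHolomorphic f) (hg : IsHolomorphic g) :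
    IsHolomorphic (f - g) := by
  have : f - g = f + (-1 : ℂ) • g := by
    rw [neg_one_smul, sub_eq_add_neg]
  rw [this]
  exact hf.add (hg.smul _)

/-- `X` is, through `ev`, the space of all analytic functions of finite `N`-norm, the point
evaluations are locally bounded, and multiplication by bounded analytic functions is
well behaved. -/
structure IsAnalyticSpace {X : Type*} [NormedAddCommGroup X] [NormedSpace ℂ X]
    (ev : X →ₗ[ℂ] (Disc → ℂ)) (N : (Disc → ℂ) → ℝ≥0∞) (M : HInfty → X →L[ℂ] X) : Prop where
  holomorphic : ∀ x, IsHolomorphic (ev x)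
  norm_eq : ∀ x, N (ev x) = ENNReal.ofReal ‖x‖
  exists_eq : ∀ f, IsHolomorphic f → N f < ∞ → ∃ x, ev x = f
  one_lt_top : N 1 < ∞
  ev_mul : ∀ g x, ev (M g x) = g.toFun * ev x
  mul_le : ∀ (g : HInfty) f, N (g.toFun * f) ≤ ENNReal.ofReal g.supNorm * N f
  le_liminf : ∀ (F : ℕ → Disc → ℂ) (f : Disc → ℂ), (∀ n, IsHolomorphic (F n)) →
    (∀ z, Tendsto (fun n => F n z) atTop (𝓝 (f z))) → N f ≤ liminf (fun n => N (F n)) atTop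
  point_le : ∀ R < (1 : ℝ), ∃ C : ℝ≥0∞, C ≠ ∞ ∧ ∀ f, IsHolomorphic f →
    ∀ z : Disc, ‖(z : ℂ)‖ ≤ R → ‖f z‖ₑ ≤ C * N f
  mul_tendsto : ∀ (f : Disc → ℂ), IsHolomorphic f → N f < ∞ → ∀ (B t₀ : ℝ) (G : ℝ → Disc → ℂ),
    (∀ t, IsHolomorphic (G t)) → (∀ᶠ t in 𝓝 t₀, ∀ z, ‖G t z‖ ≤ B) →
    Tendsto (fun t => N (G t)) (𝓝 t₀) (𝓝 0) → Tendsto (fun t => N (G t * f)) (𝓝 t₀) (𝓝 0)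

namespace IsAnalyticSpace

variable {X : Type*} [NormedAddCommGroup X] [NormedSpace ℂ X]
  {ev : X →ₗ[ℂ] (Disc → ℂ)} {N : (Disc → ℂ) → ℝ≥0∞} {M : HInfty → X →L[ℂ] X}

theorem norm_ev_le (h : IsAnalyticSpace ev N M) {R : ℝ} (hR : R < 1) :
    ∃ C : ℝ, ∀ x, ∀ z : Disc, ‖(z : ℂ)‖ ≤ R → ‖ev x z‖ ≤ C * ‖x‖ := by
  obtain ⟨C, hC, hb⟩ := h.point_le R hR
  refine ⟨C.toReal, fun x z hz => ?_⟩
  have h1 := hb (ev x) (h.holomorphic x) z hz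
  rw [h.norm_eq] at h1
  have h2 := ENNReal.toReal_mono (ENNReal.mul_ne_top hC ENNReal.ofReal_ne_top) h1
  rwa [ENNReal.toReal_mul, ENNReal.toReal_ofReal (norm_nonneg _), toReal_enorm] at h2

/-- Needed for Banach-Steinhaus. Bounded point evaluations make a Cauchy sequence converge locally
uniformly, so its limit is analytic; the Fatou property `le_liminf` then turns the Cauchy estimate
into norm convergence. -/
theorem completeSpace (h : IsAnalyticSpace ev N M) : CompleteSpace X := by
  refine Metric.complete_of_cauchySeq_tendsto fun u hu => ?_
  have hcauchy : ∀ z : Disc, CauchySeq fun n => ev (u n) z := by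
    intro z
    obtain ⟨C, hC⟩ := h.norm_ev_le (R := ‖(z : ℂ)‖) (mem_ball_zero_iff.1 z.2)
    let L : X →L[ℂ] ℂ := LinearMap.mkContinuous ((LinearMap.proj z).comp ev) C
      fun x => hC x z le_rfl
    exact L.uniformContinuous.comp_cauchySeq hu
  choose f hf using fun z => cauchySeq_tendsto_of_complete (hcauchy z)
  have hfh : IsHolomorphic f := by
    have hloc : TendstoLocallyUniformlyOn (fun n => discExt (ev (u n))) (discExt f) atTop
        (Metric.ball (0 : ℂ) 1) := by
      rw [tendstoLocallyUniformlyOn_iff_forall_isCompact Metric.isOpen_ball]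
      intro K hK hKc
      obtain ⟨R, hR1, hR⟩ : ∃ R < (1 : ℝ), ∀ z ∈ K, ‖z‖ ≤ R := by
        rcases K.eq_empty_or_nonempty with rfl | hne
        · exact ⟨0, one_pos, by simp⟩
        · obtain ⟨w, hw, hmax⟩ := hKc.exists_isMaxOn hne continuous_norm.continuousOn
          exact ⟨‖w‖, mem_ball_zero_iff.1 (hK hw), fun z hz => hmax hz⟩
      obtain ⟨C, hC⟩ := h.norm_ev_le hR1
      refine UniformCauchySeqOn.tendstoUniformlyOn_of_tendsto ?_ fun z hz => ?_
      · rw [Metric.uniformCauchySeqOn_iff]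
        intro ε hε
        -- `C` carries no sign condition, whence `|C| + 1` in the denominator.
        obtain ⟨n₀, hn₀⟩ := Metric.cauchySeq_iff.1 hu (ε / (|C| + 1)) (by positivity)
        refine ⟨n₀, fun m hm n hn z hz => ?_⟩
        have hz' := discExt_coe (ev (u m)) ⟨z, hK hz⟩
        have hz'' := discExt_coe (ev (u n)) ⟨z, hK hz⟩
        simp only at hz' hz''
        have h1 := hC (u m - u n) ⟨z, hK hz⟩ (hR z hz)
        rw [map_sub, Pi.sub_apply, ← hz', ← hz'', ← dist_eq_norm, ← dist_eq_norm] at h1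
        have h2 := hn₀ m hm n hn
        rw [lt_div_iff₀ (by positivity)] at h2
        nlinarith [le_abs_self C, dist_nonneg (x := u m) (y := u n)]
      · have h1 := hf ⟨z, hK hz⟩
        have h2 : ∀ φ : Disc → ℂ, discExt φ z = φ ⟨z, hK hz⟩ :=
          fun φ => discExt_coe φ ⟨z, hK hz⟩
        simpa only [h2] using h1
    exact hloc.differentiableOn (.of_forall fun n => h.holomorphic (u n)) Metric.isOpen_ball
  have hclose : ∀ ε > 0, ∃ n₀, ∀ n ≥ n₀, N (ev (u n) - f) ≤ ENNReal.ofReal ε := by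
    intro ε hε
    obtain ⟨n₀, hn₀⟩ := Metric.cauchySeq_iff.1 hu ε hε
    refine ⟨n₀, fun n hn => ?_⟩
    refine (h.le_liminf (fun m => ev (u n - u m)) _ (fun m => h.holomorphic _) fun z => ?_).trans ?_
    · simp only [map_sub, Pi.sub_apply]
      exact tendsto_const_nhds.sub (hf z)
    · refine (liminf_le_liminf (v := fun _ => ENNReal.ofReal ε) ?_).trans_eq (liminf_const _)
      filter_upwards [eventually_ge_atTop n₀] with m hm
      rw [h.norm_eq, ← dist_eq_norm]
      exact ENNReal.ofReal_le_ofReal (hn₀ n hn m hm).le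
  obtain ⟨n₁, hn₁⟩ := hclose 1 one_pos
  -- `N` is not assumed subadditive, so the difference, whose norm is known to be finite, is lifted
  -- to `X` in place of `f`.
  obtain ⟨y, hy⟩ := h.exists_eq (ev (u n₁) - f) ((h.holomorphic _).sub hfh)
    ((hn₁ n₁ le_rfl).trans_lt ENNReal.ofReal_lt_top)
  have hx : ev (u n₁ - y) = f := by rw [map_sub, hy, sub_sub_cancel]
  refine ⟨u n₁ - y, Metric.tendsto_atTop.2 fun ε hε => ?_⟩
  obtain ⟨n₀, hn₀⟩ := hclose (ε / 2) (half_pos hε)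
  refine ⟨n₀, fun n hn => ?_⟩
  have h1 := hn₀ n hn
  rw [← hx, ← map_sub, h.norm_eq, ← dist_eq_norm, ENNReal.ofReal_le_ofReal_iff (by positivity)]
    at h1
  linarith

/-- The upper bound is `mul_le`. For the lower one, evaluation at `z` is an eigenvector of the
adjoint of `M g` with eigenvalue `g z`, and it is nonzero because it takes the value 1 at the
constant function 1. -/
theorem norm_mulOp (h : IsAnalyticSpace ev N M) (g : HInfty) : ‖M g‖ = g.supNorm := by
  obtain ⟨e, he⟩ := h.exists_eq 1 isHolomorphic_one h.one_lt_top
  refine le_antisymm (ContinuousLinearMap.opNorm_le_bound _ g.supNorm_nonneg fun x => ?_) ?_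
  · have h1 := h.mul_le g (ev x)
    rw [← h.ev_mul, h.norm_eq, h.norm_eq, ← ENNReal.ofReal_mul g.supNorm_nonneg,
      ENNReal.ofReal_le_ofReal_iff (mul_nonneg g.supNorm_nonneg (norm_nonneg _))] at h1
    exact h1
  · have : Nonempty Disc := ⟨⟨0, by simp⟩⟩
    refine ciSup_le fun z => ?_
    obtain ⟨C, hC⟩ := h.norm_ev_le (R := ‖(z : ℂ)‖) (mem_ball_zero_iff.1 z.2)
    let L : X →L[ℂ] ℂ := LinearMap.mkContinuous ((LinearMap.proj z).comp ev) C
      fun x => hC x z le_rfl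
    have hL : ∀ x, L x = ev x z := fun x => rfl
    have hLpos : 0 < ‖L‖ := by
      rw [norm_pos_iff]
      intro h0
      have := hL e
      rw [h0, he] at this
      simp at this
    have key : ‖g.toFun z • L‖ ≤ ‖L‖ * ‖M g‖ := by
      have : g.toFun z • L = L.comp (M g) := by
        ext x
        simp [hL, h.ev_mul]
      rw [this]
      exact L.opNorm_comp_le (M g)
    rw [norm_smul, mul_comm] at key
    exact le_of_mul_le_mul_left key hLpos

theorem tendsto_iff (h : IsAnalyticSpace ev N M) {x : ℝ → X} {y : X} {t₀ : ℝ} :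
    Tendsto x (𝓝 t₀) (𝓝 y) ↔ Tendsto (fun t => N (ev (x t) - ev y)) (𝓝 t₀) (𝓝 0) := by
  rw [tendsto_iff_norm_sub_tendsto_zero]
  simp only [← map_sub, h.norm_eq]
  constructor
  · intro h1
    simpa using ENNReal.tendsto_ofReal h1
  · intro h1
    have := (ENNReal.tendsto_toReal ENNReal.zero_ne_top).comp h1
    simpa [Function.comp_def] using this

theorem symbolsContinuous (h : IsAnalyticSpace ev N M) {g : ℝ → HInfty}
    (hc : ∀ x, ContinuousOn (fun t => M (g t) x) (Ioo 0 1)) : SymbolsContinuous N g := by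
  obtain ⟨e, he⟩ := h.exists_eq 1 isHolomorphic_one h.one_lt_top
  intro t₀ ht₀
  have h1 := h.tendsto_iff.1 ((hc e).continuousAt (Ioo_mem_nhds ht₀.1 ht₀.2))
  simpa only [h.ev_mul, he, mul_one] using h1

/-- Orbits over a compact set are bounded by continuity, so uniform boundedness applies and operator
norms are sup norms. -/
theorem symbolsLocallyBounded (h : IsAnalyticSpace ev N M) {g : ℝ → HInfty}
    (hc : ∀ x, ContinuousOn (fun t => M (g t) x) (Ioo 0 1)) : SymbolsLocallyBounded g := by
  have := h.completeSpace
  intro K hK hKs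
  obtain ⟨C, hC⟩ := banach_steinhaus (g := fun t : K => M (g t)) fun x => by
    obtain ⟨C, hC⟩ := hK.exists_bound_of_continuousOn ((hc x).mono hKs)
    exact ⟨C, fun t => hC t t.2⟩
  refine ⟨C, ?_⟩
  rintro _ ⟨t, ht, rfl⟩
  simpa only [h.norm_mulOp] using hC ⟨t, ht⟩

theorem continuousOn_mulOp (h : IsAnalyticSpace ev N M) {g : ℝ → HInfty}
    (h1 : SymbolsContinuous N g) (h2 : SymbolsLocallyBounded g) (x : X) :
    ContinuousOn (fun t => M (g t) x) (Ioo 0 1) := by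
  intro t₀ ht₀
  refine ContinuousAt.continuousWithinAt ?_
  rw [ContinuousAt, h.tendsto_iff]
  -- Condition 2 on a compact neighbourhood of `t₀` bounds the differences `g t - g t₀` by `B + B`,
  -- as `mul_tendsto` requires.
  obtain ⟨K, hKn, hKs, hK⟩ := local_compact_nhds (Ioo_mem_nhds ht₀.1 ht₀.2)
  obtain ⟨B, hB⟩ := h2 K hK hKs
  have hb : ∀ t ∈ K, (g t).supNorm ≤ B := fun t ht => hB ⟨t, ht, rfl⟩
  have key := h.mul_tendsto (ev x) (h.holomorphic x) (by rw [h.norm_eq]; exact ENNReal.ofReal_lt_top)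
    (B + B) t₀ (fun t => (g t).toFun - (g t₀).toFun)
    (fun t => (g t).holomorphic.sub (g t₀).holomorphic) ?_ (h1 t₀ ht₀)
  · simpa only [h.ev_mul, ← sub_mul] using key
  · filter_upwards [hKn] with t ht z
    exact (norm_sub_le _ _).trans (add_le_add (((g t).norm_le z).trans (hb t ht))
      (((g t₀).norm_le z).trans (hb t₀ (mem_of_mem_nhds hKn))))

theorem satisfiesW_iff (h : IsAnalyticSpace ev N M) (g : ℝ → HInfty) :
    SatisfiesW (fun t => M (g t)) ↔
      SymbolsContinuous N g ∧ SymbolsLocallyBounded g ∧ SymbolsIntegrable g := by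
  simp only [SatisfiesW, SymbolsIntegrable, h.norm_mulOp]
  exact ⟨fun hW => ⟨h.symbolsContinuous hW.1, h.symbolsLocallyBounded hW.1, hW.2⟩,
    fun hg => ⟨h.continuousOn_mulOp hg.1 hg.2.1, hg.2.2⟩⟩

theorem satisfiesPointwiseW (h : IsAnalyticSpace ev N M) {g : ℝ → HInfty}
    (hg : SymbolsContinuous N g ∧ SymbolsLocallyBounded g ∧ SymbolsIntegrable g) :
    SatisfiesPointwiseW (fun t => M (g t)) := by
  intro x
  have hc := h.continuousOn_mulOp hg.1 hg.2.1 x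
  refine ⟨hc, Integrable.mono' (hg.2.2.mul_const ‖x‖)
    (hc.norm.aestronglyMeasurable measurableSet_Ioo) (.of_forall fun t => ?_)⟩
  rw [norm_norm, ← h.norm_mulOp]
  exact (M (g t)).le_opNorm x

theorem main (h : IsAnalyticSpace ev N M) (g : ℝ → HInfty) :
    (SatisfiesW (fun t => M (g t)) ↔
        SymbolsContinuous N g ∧ SymbolsLocallyBounded g ∧ SymbolsIntegrable g) ∧
      (SymbolsContinuous N g ∧ SymbolsLocallyBounded g ∧ SymbolsIntegrable g →
        SatisfiesPointwiseW (fun t => M (g t))) ∧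
      (SatisfiesPointwiseW (fun t => M (g t)) →
        SymbolsContinuous N g ∧ SymbolsLocallyBounded g) :=
  ⟨h.satisfiesW_iff g, h.satisfiesPointwiseW, fun hW =>
    ⟨h.symbolsContinuous fun x => (hW x).1, h.symbolsLocallyBounded fun x => (hW x).1⟩⟩

end IsAnalyticSpace

/-! ### Point evaluations on Hardy spaces -/

instance isProbabilityMeasure_angleMeasure : IsProbabilityMeasure angleMeasure := by
  refine ⟨?_⟩
  have := Real.two_pi_pos
  rw [angleMeasure, Measure.smul_apply, Measure.restrict_apply_univ, Real.volume_Ioc, sub_zero,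
    smul_eq_mul, ← ENNReal.ofReal_mul (by positivity), inv_mul_cancel₀ this.ne',
    ENNReal.ofReal_one]

theorem circleAverage_eq_integral_angleMeasure {E : Type*} [NormedAddCommGroup E]
    [NormedSpace ℝ E] (f : ℂ → E) (c : ℂ) (r : ℝ) :
    Real.circleAverage f c r = ∫ θ, f (circleMap c r θ) ∂angleMeasure := by
  have := Real.two_pi_pos
  rw [Real.circleAverage, angleMeasure, integral_smul_measure,
    intervalIntegral.integral_of_le this.le, ENNReal.toReal_ofReal (by positivity)]

theorem Disc.discExt_of_mem (f : Disc → ℂ) {z : ℂ} (hz : z ∈ Metric.ball (0 : ℂ) 1) :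
    discExt f z = f ⟨z, hz⟩ := discExt_coe f ⟨z, hz⟩

theorem Disc.discExt_of_notMem (f : Disc → ℂ) {z : ℂ} (hz : z ∉ Metric.ball (0 : ℂ) 1) :
    discExt f z = 0 := by
  simp only [discExt, dif_neg hz]

/-- Cauchy's formula on one circle of radius `r < 1` bounds `f z` by the `L¹` mean there, and for a
probability measure this is at most the `L^p` mean. -/
theorem hardy_point_le {p : ℝ≥0∞} (hp : 1 ≤ p) {R : ℝ} (hR : R < 1) :
    ∃ C : ℝ≥0∞, C ≠ ∞ ∧ ∀ f, IsHolomorphic f →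
      ∀ z : Disc, ‖(z : ℂ)‖ ≤ R → ‖f z‖ₑ ≤ C * hardyENorm p f := by
  -- Halfway between the points evaluated and the boundary; the maximum keeps `r` positive even for
  -- negative `R`.
  set r := (max R 0 + 1) / 2 with hr
  have hR0 : 0 ≤ max R 0 := le_max_right _ _
  have hR1 : max R 0 < 1 := max_lt hR one_pos
  have hr0 : 0 < r := by linarith
  have hr1 : r < 1 := by linarith
  have hrR : 0 < r - max R 0 := by linarith
  refine ⟨ENNReal.ofReal (r / (r - max R 0)), ENNReal.ofReal_ne_top, fun f hf z hz => ?_⟩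
  have hsub : Metric.closedBall (0 : ℂ) |r| ⊆ Metric.ball 0 1 :=
    Metric.closedBall_subset_ball (by rwa [abs_of_pos hr0])
  have hd : DiffContOnCl ℂ (discExt f) (Metric.ball 0 |r|) :=
    (hf.mono hsub).diffContOnCl_ball Subset.rfl
  have hzr : ‖(z : ℂ)‖ ≤ max R 0 := hz.trans (le_max_left _ _)
  have h1 := DiffContOnCl.circleAverage_smul_div (w := (z : ℂ)) hd (by
    rw [mem_ball_zero_iff, abs_of_pos hr0]; linarith)
  rw [discExt_coe, circleAverage_eq_integral_angleMeasure] at h1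
  calc ‖f z‖ₑ ≤ ∫⁻ θ, ‖((circleMap 0 r θ - 0) / (circleMap 0 r θ - z)) •
        discExt f (circleMap 0 r θ)‖ₑ ∂angleMeasure := by
        rw [← h1]; exact enorm_integral_le_lintegral_enorm _
    _ ≤ ∫⁻ θ, ENNReal.ofReal (r / (r - max R 0)) * ‖discExt f (circleMap 0 r θ)‖ₑ
        ∂angleMeasure := by
        refine lintegral_mono fun θ => ?_
        dsimp only
        rw [enorm_smul]
        refine mul_le_mul_left ?_ _
        rw [← ofReal_norm]
        refine ENNReal.ofReal_le_ofReal ?_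
        rw [norm_div, sub_zero, norm_circleMap_zero, abs_of_pos hr0]
        refine div_le_div_of_nonneg_left hr0.le hrR ?_
        have := norm_sub_norm_le (circleMap 0 r θ) z
        rw [norm_circleMap_zero, abs_of_pos hr0] at this
        linarith
    _ = ENNReal.ofReal (r / (r - max R 0)) * circleMean 1 r f := by
        rw [lintegral_const_mul' _ _ ENNReal.ofReal_ne_top, circleMean,
          eLpNorm_one_eq_lintegral_enorm]
    _ ≤ ENNReal.ofReal (r / (r - max R 0)) * hardyENorm p f := by
        refine mul_le_mul_right ?_ _
        refine le_trans ?_ (le_iSup₂ (f := fun r _ => circleMean p r f) r ⟨hr0.le, hr1⟩)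
        exact eLpNorm_le_eLpNorm_of_exponent_le hp
          (continuous_circle hf ⟨hr0.le, hr1⟩).aestronglyMeasurable

theorem tendsto_discExt {F : ℕ → Disc → ℂ} {f : Disc → ℂ}
    (h : ∀ z, Tendsto (fun n => F n z) atTop (𝓝 (f z))) (z : ℂ) :
    Tendsto (fun n => discExt (F n) z) atTop (𝓝 (discExt f z)) := by
  by_cases hz : z ∈ Metric.ball (0 : ℂ) 1
  · simpa only [discExt_of_mem _ hz] using h ⟨z, hz⟩
  · simpa only [discExt_of_notMem _ hz] using tendsto_const_nhds

theorem hardyENorm_le_liminf (p : ℝ≥0∞) {F : ℕ → Disc → ℂ} {f : Disc → ℂ}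
    (hF : ∀ n, IsHolomorphic (F n)) (h : ∀ z, Tendsto (fun n => F n z) atTop (𝓝 (f z))) :
    hardyENorm p f ≤ liminf (fun n => hardyENorm p (F n)) atTop := by
  refine iSup₂_le fun r hr => ?_
  refine (Lp.eLpNorm_lim_le_liminf_eLpNorm
    (fun n => (continuous_circle (hF n) hr).aestronglyMeasurable) _
    (.of_forall fun θ => tendsto_discExt h _)).trans ?_
  exact liminf_le_liminf (.of_forall fun n => le_iSup₂ (f := fun r _ => circleMean p r (F n)) r hr)

theorem hardyENorm_one_lt_top (p : ℝ≥0∞) : hardyENorm p 1 < ∞ := by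
  refine lt_of_le_of_lt (iSup₂_le fun r hr => ?_) ENNReal.one_lt_top
  refine (eLpNorm_le_of_ae_bound (C := 1) (.of_forall fun θ => ?_)).trans ?_
  · by_cases hz : circleMap 0 r θ ∈ Metric.ball (0 : ℂ) 1
    · simp [discExt_of_mem _ hz]
    · simp [discExt_of_notMem _ hz]
  · simp

/-! ### Point evaluations on Bergman spaces -/

theorem Disc.IsHolomorphic.measurable {f : Disc → ℂ} (hf : IsHolomorphic f) :
    Measurable (discExt f) := by
  classical
  have : discExt f = (Metric.ball (0 : ℂ) 1).piecewise (discExt f) 0 := by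
    funext z
    by_cases hz : z ∈ Metric.ball (0 : ℂ) 1
    · rw [piecewise_eq_of_mem _ _ _ hz]
    · rw [piecewise_eq_of_notMem _ _ _ hz, discExt_of_notMem _ hz, Pi.zero_apply]
  rw [this]
  exact hf.continuousOn.measurable_piecewise continuousOn_const Metric.isOpen_ball.measurableSet

theorem bergmanENorm_le_liminf (p : ℝ≥0∞) (α : ℝ) {F : ℕ → Disc → ℂ} {f : Disc → ℂ}
    (hF : ∀ n, IsHolomorphic (F n)) (h : ∀ z, Tendsto (fun n => F n z) atTop (𝓝 (f z))) :
    bergmanENorm p α f ≤ liminf (fun n => bergmanENorm p α (F n)) atTop :=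
  Lp.eLpNorm_lim_le_liminf_eLpNorm (fun n => aestronglyMeasurable_bergman α (hF n)) _
    (.of_forall fun z => tendsto_discExt h z)

/-- Integration over a disk in polar coordinates centred at its centre. -/
theorem setLIntegral_ball_eq_lintegral_circleMap {φ : ℂ → ℝ≥0∞} (hφ : Measurable φ) (c : ℂ)
    (s : ℝ) : ∫⁻ w in Metric.ball c s, φ w =
      ∫⁻ r in Ioo 0 s, ENNReal.ofReal r * ∫⁻ θ in Ioo (-Real.pi) Real.pi, φ (circleMap c r θ) := by
  have hcm : Measurable fun x : ℝ × ℝ => circleMap c x.1 x.2 := by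
    unfold circleMap
    fun_prop
  have h1 : ∫⁻ w in Metric.ball c s, φ w =
      ∫⁻ w, (Metric.ball c s).indicator φ (c + w) := by
    rw [lintegral_add_left_eq_self (fun w => (Metric.ball c s).indicator φ w) c,
      lintegral_indicator Metric.isOpen_ball.measurableSet]
  have h2 : ∀ x ∈ polarCoord.target, ENNReal.ofReal x.1 •
      (Metric.ball c s).indicator φ (c + Complex.polarCoord.symm x) =
      (Iio s).indicator (fun r => ENNReal.ofReal r * φ (circleMap c r x.2)) x.1 := by
    rintro ⟨r, θ⟩ ⟨hr, -⟩
    have hr : 0 < r := hr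
    have h3 : c + Complex.polarCoord.symm (r, θ) = circleMap c r θ := by
      rw [Complex.polarCoord_symm_apply, circleMap, Complex.exp_mul_I]
      simp
    have h4 : circleMap c r θ ∈ Metric.ball c s ↔ r ∈ Iio s := by
      rw [mem_ball_iff_norm, circleMap_sub_center, norm_circleMap_zero, abs_of_pos hr, mem_Iio]
    rw [h3]
    by_cases hs : r ∈ Iio s
    · rw [indicator_of_mem (h4.2 hs), indicator_of_mem hs, smul_eq_mul]
    · rw [indicator_of_notMem (mt h4.1 hs), indicator_of_notMem hs, smul_zero]
  rw [h1, ← Complex.lintegral_comp_polarCoord_symm,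
    setLIntegral_congr_fun polarCoord.open_target.measurableSet h2, polarCoord_target,
    Measure.volume_eq_prod, ← Measure.prod_restrict, lintegral_prod]
  · have h5 : ∀ r : ℝ, ∫⁻ θ in Ioo (-Real.pi) Real.pi,
        (Iio s).indicator (fun r => ENNReal.ofReal r * φ (circleMap c r θ)) r =
        (Iio s).indicator (fun r => ENNReal.ofReal r *
          ∫⁻ θ in Ioo (-Real.pi) Real.pi, φ (circleMap c r θ)) r := by
      intro r
      by_cases hs : r ∈ Iio s
      · simp only [indicator_of_mem hs]
        rw [lintegral_const_mul' _ _ ENNReal.ofReal_ne_top]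
      · simp only [indicator_of_notMem hs, lintegral_zero]
    simp only [h5]
    rw [lintegral_indicator measurableSet_Iio, Measure.restrict_restrict measurableSet_Iio,
      inter_comm, Ioi_inter_Iio]
  · refine Measurable.aemeasurable ?_
    have : (fun x : ℝ × ℝ => (Iio s).indicator
        (fun r => ENNReal.ofReal r * φ (circleMap c r x.2)) x.1) =
        (Prod.fst ⁻¹' Iio s).indicator
          fun x : ℝ × ℝ => ENNReal.ofReal x.1 * φ (circleMap c x.1 x.2) := by
      funext x
      simp [indicator]
    rw [this]
    exact Measurable.indicator ((measurable_fst.ennreal_ofReal).mul (hφ.comp hcm))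
      (measurable_fst measurableSet_Iio)

/-- The mean value property. Leaving the constant under an unnormalized integral lets it be compared
with the polar form of the area integral circle by circle. -/
theorem enorm_le_lintegral_circleMap {f : ℂ → ℂ} {c : ℂ} {r : ℝ}
    (hf : DiffContOnCl ℂ f (Metric.ball c |r|)) :
    ∫⁻ _ in Ioo (-Real.pi) Real.pi, ‖f c‖ₑ ≤
      ∫⁻ θ in Ioo (-Real.pi) Real.pi, ‖f (circleMap c r θ)‖ₑ := by
  have h2π := Real.two_pi_pos
  have h := hf.circleAverage
  rw [Real.circleAverage_eq_integral_add (-Real.pi),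
    intervalIntegral.integral_comp_add_right (fun θ => f (circleMap c r θ)), zero_add,
    inv_smul_eq_iff₀ h2π.ne', show 2 * Real.pi + -Real.pi = Real.pi by ring,
    intervalIntegral.integral_of_le (by linarith)] at h
  rw [setLIntegral_const, Real.volume_Ioo, show Real.pi - -Real.pi = 2 * Real.pi by ring,
    restrict_Ioo_eq_restrict_Ioc, mul_comm, ← Real.enorm_of_nonneg h2π.le, ← enorm_smul, ← h]
  exact enorm_integral_le_lintegral_enorm _

theorem enorm_mul_volume_ball_le {f : Disc → ℂ} (hf : IsHolomorphic f) {c : ℂ} {s : ℝ}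
    (hs : Metric.ball c s ⊆ Metric.ball 0 1) :
    ‖discExt f c‖ₑ * volume (Metric.ball c s) ≤ ∫⁻ w in Metric.ball c s, ‖discExt f w‖ₑ := by
  rw [← setLIntegral_const, setLIntegral_ball_eq_lintegral_circleMap measurable_const,
    setLIntegral_ball_eq_lintegral_circleMap hf.measurable.enorm]
  refine setLIntegral_mono' measurableSet_Ioo fun r hr => mul_le_mul_right ?_ _
  refine enorm_le_lintegral_circleMap ((hf.mono ?_).diffContOnCl_ball Subset.rfl)
  rw [abs_of_pos hr.1]
  exact (Metric.closedBall_subset_ball hr.2).trans hs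

/-- In polar coordinates the weight factors as `(1 - y) ^ α`, integrable up to 1 because `α > -1`,
times `(1 + y) ^ α * y`, continuous on the closed interval. -/
theorem integrableOn_bergman_weight {α : ℝ} (hα : -1 < α) :
    IntegrableOn (fun z : ℂ => (1 - ‖z‖ ^ 2) ^ α) (Metric.ball 0 1) := by
  rw [integrableOn_fun_norm_addHaar volume (f := fun y : ℝ => (1 - y ^ 2) ^ α)]
  have h1 : IntervalIntegrable (fun y : ℝ => (1 - y) ^ α) volume 0 1 := by
    simpa using ((intervalIntegral.intervalIntegrable_rpow' (a := 0) (b := 1) hα).comp_sub_left 1).symm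
  have h2 : ContinuousOn (fun y : ℝ => (1 + y) ^ α * y) (uIcc 0 1) := by
    refine ContinuousOn.mul (ContinuousOn.rpow_const (by fun_prop) fun y hy => ?_) continuousOn_id
    rw [uIcc_of_le zero_le_one] at hy
    exact Or.inl (by linarith [hy.1])
  have h3 := (h1.mul_continuousOn h2).1.mono_set Ioo_subset_Ioc_self
  refine h3.congr_fun (fun y hy => ?_) measurableSet_Ioo
  have h4 : (1 - y ^ 2) = (1 - y) * (1 + y) := by ring
  simp only [Complex.finrank_real_complex, smul_eq_mul]
  rw [h4, Real.mul_rpow (by linarith [hy.2]) (by linarith [hy.1])]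
  ring

theorem isFiniteMeasure_bergmanMeasure {α : ℝ} (hα : -1 < α) :
    IsFiniteMeasure (bergmanMeasure α) :=
  isFiniteMeasure_withDensity_ofReal
    ((integrableOn_bergman_weight hα).const_mul ((α + 1) / Real.pi)).2

/-- Away from the boundary the weight is bounded below: by its value at radius `ρ` if `α ≥ 0`, and
by 1 if `α ≤ 0`. The minimum covers both signs. -/
theorem exists_smul_restrict_ball_le_bergmanMeasure {α : ℝ} (hα : -1 < α) {ρ : ℝ} (h0 : 0 ≤ ρ)
    (hρ : ρ < 1) : ∃ c : ℝ≥0∞, c ≠ 0 ∧ c ≠ ∞ ∧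
      c • volume.restrict (Metric.ball (0 : ℂ) ρ) ≤ bergmanMeasure α := by
  have h1 : 0 < 1 - ρ ^ 2 := by nlinarith
  have h2 : 0 < (α + 1) / Real.pi := div_pos (by linarith) Real.pi_pos
  have h3 : 0 < min 1 ((1 - ρ ^ 2) ^ α) := lt_min one_pos (Real.rpow_pos_of_pos h1 α)
  refine ⟨ENNReal.ofReal ((α + 1) / Real.pi * min 1 ((1 - ρ ^ 2) ^ α)),
    (ENNReal.ofReal_pos.2 (mul_pos h2 h3)).ne', ENNReal.ofReal_ne_top, ?_⟩
  have h4 : volume.restrict (Metric.ball (0 : ℂ) ρ) =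
      (volume.restrict (Metric.ball (0 : ℂ) 1)).restrict (Metric.ball (0 : ℂ) ρ) := by
    rw [Measure.restrict_restrict Metric.isOpen_ball.measurableSet,
      inter_eq_left.2 (Metric.ball_subset_ball hρ.le)]
  rw [h4, ← withDensity_const, ← withDensity_indicator Metric.isOpen_ball.measurableSet,
    bergmanMeasure]
  refine withDensity_mono (.of_forall fun z => ?_)
  by_cases hz : z ∈ Metric.ball (0 : ℂ) ρ
  · rw [indicator_of_mem hz]
    refine ENNReal.ofReal_le_ofReal (mul_le_mul_of_nonneg_left ?_ h2.le)
    rw [mem_ball_zero_iff] at hz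
    have h5 : 1 - ρ ^ 2 ≤ 1 - ‖z‖ ^ 2 := by nlinarith [norm_nonneg z]
    rcases le_total 0 α with h | h
    · exact (min_le_right _ _).trans (Real.rpow_le_rpow h1.le h5 h)
    · exact (min_le_left _ _).trans
        (Real.one_le_rpow_of_pos_of_le_one_of_nonpos (h1.trans_le h5)
          (by nlinarith [sq_nonneg ‖z‖]) h)
  · rw [indicator_of_notMem hz]
    exact zero_le

/-- The area mean over a disk of fixed radius `s` about `z` dominates `|f z|`. That disk stays where
the Bergman measure dominates a multiple of area, and Hölder on a finite measure passes from `L¹` to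
`L^p` at the cost of the factor `T`. -/
theorem bergman_point_le {p : ℝ≥0∞} (hp : 1 ≤ p) {α : ℝ} (hα : -1 < α) {R : ℝ} (hR : R < 1) :
    ∃ C : ℝ≥0∞, C ≠ ∞ ∧ ∀ f, IsHolomorphic f →
      ∀ z : Disc, ‖(z : ℂ)‖ ≤ R → ‖f z‖ₑ ≤ C * bergmanENorm p α f := by
  have := isFiniteMeasure_bergmanMeasure hα
  have hR0 : 0 ≤ max R 0 := le_max_right _ _
  have hR1 : max R 0 < 1 := max_lt hR one_pos
  set s := (1 - max R 0) / 2 with hs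
  have hs0 : 0 < s := by linarith
  obtain ⟨c, hc0, hct, hc⟩ := exists_smul_restrict_ball_le_bergmanMeasure hα
    (show 0 ≤ max R 0 + s by linarith) (show max R 0 + s < 1 by linarith)
  set V := volume (Metric.ball (0 : ℂ) s) with hV
  have hV0 : V ≠ 0 := (Metric.measure_ball_pos volume _ hs0).ne'
  have hVt : V ≠ ∞ := measure_ball_lt_top.ne
  set T := bergmanMeasure α univ ^ (1 / (1 : ℝ≥0∞).toReal - 1 / p.toReal) with hT
  have hTt : T ≠ ∞ := by
    refine ENNReal.rpow_ne_top_of_nonneg ?_ (measure_ne_top _ _)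
    rw [ENNReal.toReal_one, sub_nonneg]
    rcases eq_or_ne p ∞ with rfl | hpt
    · simp
    · have : 1 ≤ p.toReal := by
        simpa using ENNReal.toReal_mono hpt hp
      exact one_div_le_one_div_of_le one_pos this
  refine ⟨(c * V)⁻¹ * T, ENNReal.mul_ne_top (ENNReal.inv_ne_top.2 (mul_ne_zero hc0 hV0)) hTt,
    fun f hf z hz => ?_⟩
  have hzR : ‖(z : ℂ)‖ ≤ max R 0 := hz.trans (le_max_left _ _)
  have hsub : Metric.ball (z : ℂ) s ⊆ Metric.ball 0 (max R 0 + s) :=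
    Metric.ball_subset_ball' (by rw [dist_zero_right]; linarith)
  have h1 := enorm_mul_volume_ball_le hf
    (hsub.trans (Metric.ball_subset_ball (show max R 0 + s ≤ 1 by linarith)))
  rw [discExt_coe, Measure.addHaar_ball_center, ← hV] at h1
  have h2 : c * ∫⁻ w in Metric.ball (z : ℂ) s, ‖discExt f w‖ₑ ≤ bergmanENorm p α f * T := by
    calc c * ∫⁻ w in Metric.ball (z : ℂ) s, ‖discExt f w‖ₑ
        ≤ c * ∫⁻ w in Metric.ball (0 : ℂ) (max R 0 + s), ‖discExt f w‖ₑ :=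
          mul_le_mul_right (lintegral_mono_set hsub) _
      _ = ∫⁻ w, ‖discExt f w‖ₑ ∂(c • volume.restrict (Metric.ball (0 : ℂ) (max R 0 + s))) := by
          rw [lintegral_smul_measure, smul_eq_mul]
      _ ≤ ∫⁻ w, ‖discExt f w‖ₑ ∂(bergmanMeasure α) := lintegral_mono' hc le_rfl
      _ = eLpNorm (discExt f) 1 (bergmanMeasure α) := eLpNorm_one_eq_lintegral_enorm.symm
      _ ≤ bergmanENorm p α f * T :=
          eLpNorm_le_eLpNorm_mul_rpow_measure_univ hp (aestronglyMeasurable_bergman α hf)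
  have h3 : ‖f z‖ₑ * (c * V) ≤ bergmanENorm p α f * T := by
    refine le_trans ?_ h2
    rw [mul_left_comm]
    exact mul_le_mul_right h1 c
  calc ‖f z‖ₑ ≤ bergmanENorm p α f * T / (c * V) :=
        (ENNReal.le_div_iff_mul_le (Or.inl (mul_ne_zero hc0 hV0))
          (Or.inl (ENNReal.mul_ne_top hct hVt))).2 h3
    _ = (c * V)⁻¹ * T * bergmanENorm p α f := by rw [div_eq_mul_inv]; ring

theorem bergmanENorm_one_lt_top (p : ℝ≥0∞) {α : ℝ} (hα : -1 < α) : bergmanENorm p α 1 < ∞ := by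
  have := isFiniteMeasure_bergmanMeasure hα
  refine (MemLp.of_bound (aestronglyMeasurable_bergman α isHolomorphic_one) 1
    (.of_forall fun z => ?_)).2
  by_cases hz : z ∈ Metric.ball (0 : ℂ) 1
  · simp [discExt_of_mem _ hz]
  · simp [discExt_of_notMem _ hz]

/-- Dominated convergence in Bergman spaces. -/
theorem bergmanENorm_mul_tendsto {p : ℝ≥0∞} (hp : 1 ≤ p) (hpt : p ≠ ∞) {α : ℝ} (hα : -1 < α)
    {f : Disc → ℂ} (hf : IsHolomorphic f) (hfN : bergmanENorm p α f < ∞) (B t₀ : ℝ)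
    (G : ℝ → Disc → ℂ) (hG : ∀ t, IsHolomorphic (G t)) (hB : ∀ᶠ t in 𝓝 t₀, ∀ z, ‖G t z‖ ≤ B)
    (hN : Tendsto (fun t => bergmanENorm p α (G t)) (𝓝 t₀) (𝓝 0)) :
    Tendsto (fun t => bergmanENorm p α (G t * f)) (𝓝 t₀) (𝓝 0) := by
  have hp0 : p ≠ 0 := (zero_lt_one.trans_le hp).ne'
  have hq : 0 < p.toReal := ENNReal.toReal_pos hp0 hpt
  -- Bounded point evaluations turn norm convergence into the pointwise convergence needed below.
  have hpt' : ∀ z : Disc, Tendsto (fun t => ‖G t z‖ₑ) (𝓝 t₀) (𝓝 0) := by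
    intro z
    obtain ⟨C, hC, hb⟩ := bergman_point_le hp hα (R := ‖(z : ℂ)‖) (mem_ball_zero_iff.1 z.2)
    have h1 : Tendsto (fun t => C * bergmanENorm p α (G t)) (𝓝 t₀) (𝓝 0) := by
      simpa using ENNReal.Tendsto.const_mul hN (Or.inr hC)
    exact tendsto_of_tendsto_of_tendsto_of_le_of_le tendsto_const_nhds h1 (fun t => zero_le)
      fun t => hb (G t) (hG t) z le_rfl
  have key : Tendsto (fun t => ∫⁻ z, ‖discExt (G t * f) z‖ₑ ^ p.toReal ∂(bergmanMeasure α)) (𝓝 t₀)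
      (𝓝 (∫⁻ _, 0 ∂(bergmanMeasure α))) := by
    refine tendsto_lintegral_filter_of_dominated_convergence
      (fun z => ENNReal.ofReal B ^ p.toReal * ‖discExt f z‖ₑ ^ p.toReal)
      (.of_forall fun t => ((hG t).mul hf).measurable.enorm.pow_const _) ?_ ?_
      (.of_forall fun z => ?_)
    · filter_upwards [hB] with t ht
      refine .of_forall fun z => ?_
      rw [← ENNReal.mul_rpow_of_nonneg _ _ hq.le]
      refine ENNReal.rpow_le_rpow ?_ hq.le
      rw [discExt_mul, Pi.mul_apply, enorm_mul]
      refine mul_le_mul_left ?_ _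
      by_cases hz : z ∈ Metric.ball (0 : ℂ) 1
      · rw [discExt_of_mem _ hz, ← ofReal_norm]
        exact ENNReal.ofReal_le_ofReal (ht _)
      · rw [discExt_of_notMem _ hz, enorm_zero]
        exact zero_le
    · rw [lintegral_const_mul' _ _ (ENNReal.rpow_ne_top_of_nonneg hq.le ENNReal.ofReal_ne_top)]
      exact ENNReal.mul_ne_top (ENNReal.rpow_ne_top_of_nonneg hq.le ENNReal.ofReal_ne_top)
        ((eLpNorm_lt_top_iff_lintegral_rpow_enorm_lt_top hp0 hpt).1 hfN).ne
    · by_cases hz : z ∈ Metric.ball (0 : ℂ) 1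
      · simp only [Pi.mul_apply, discExt_of_mem _ hz, enorm_mul]
        have h1 := ENNReal.Tendsto.mul_const (hpt' ⟨z, hz⟩) (b := ‖f ⟨z, hz⟩‖ₑ) (Or.inr enorm_ne_top)
        rw [zero_mul] at h1
        have h2 := h1.ennrpow_const p.toReal
        rwa [ENNReal.zero_rpow_of_pos hq] at h2
      · simp [discExt_of_notMem _ hz, ENNReal.zero_rpow_of_pos hq]
  have h1 := key.ennrpow_const (1 / p.toReal)
  rw [lintegral_zero, ENNReal.zero_rpow_of_pos (by positivity)] at h1
  simpa only [bergmanENorm, eLpNorm_eq_lintegral_rpow_enorm_toReal hp0 hpt] using h1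

theorem isAnalyticSpace_bergman {p : ℝ≥0∞} [hp : Fact (1 ≤ p)] (hpt : p ≠ ∞) {α : ℝ}
    [hα : Fact (-1 < α)] :
    IsAnalyticSpace (X := Bergman p α) (bergmanSubmodule p α).subtype (bergmanENorm p α)
      (Bergman.mulOp p α) where
  holomorphic x := x.2.1
  norm_eq x := (ENNReal.ofReal_toReal x.2.2.ne).symm
  exists_eq f hf hN := ⟨⟨f, hf, hN⟩, rfl⟩
  one_lt_top := bergmanENorm_one_lt_top p hα.out
  ev_mul _ _ := rfl
  mul_le := bergmanENorm_mul_le p α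
  le_liminf _ _ := bergmanENorm_le_liminf p α
  point_le _ hR := bergman_point_le hp.out hα.out hR
  mul_tendsto _ hf hN := bergmanENorm_mul_tendsto hp.out hpt hα.out hf hN

/-! ### Square integrable power series on the circle -/

theorem lintegral_sq_sum_mul_circleMap_pow (a : ℕ → ℂ) (n : ℕ) :
    ∫⁻ θ, ‖∑ k ∈ Finset.range n, a k * circleMap 0 1 θ ^ k‖ₑ ^ 2 ∂angleMeasure =
      ∑ k ∈ Finset.range n, ‖a k‖ₑ ^ 2 := by
  set P : Polynomial ℂ := ∑ k ∈ Finset.range n, Polynomial.monomial k (a k) with hP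
  have hcoeff : ∀ k, P.coeff k = if k < n then a k else 0 := by
    intro k
    simp [hP, Polynomial.coeff_monomial]
  have heval : ∀ z, P.eval z = ∑ k ∈ Finset.range n, a k * z ^ k := by
    intro z
    simp [hP, Polynomial.eval_finsetSum]
  have h1 := P.sum_sq_norm_coeff_eq_circleAverage
  have h2 : ∑ k ∈ P.support, ‖P.coeff k‖ ^ 2 = ∑ k ∈ Finset.range n, ‖a k‖ ^ 2 := by
    rw [Finset.sum_subset (s₂ := Finset.range n)]
    · refine Finset.sum_congr rfl fun k hk => ?_
      rw [hcoeff, if_pos (Finset.mem_range.1 hk)]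
    · intro k hk
      by_contra hkn
      rw [Polynomial.mem_support_iff, hcoeff, if_neg (mt Finset.mem_range.2 hkn)] at hk
      exact hk rfl
    · intro k _ hk
      rw [Polynomial.notMem_support_iff.1 hk]
      simp
  rw [h2, circleAverage_eq_integral_angleMeasure] at h1
  simp only [heval] at h1
  have hcont : Continuous fun θ => ∑ k ∈ Finset.range n, a k * circleMap 0 1 θ ^ k := by
    have := continuous_circleMap 0 1
    fun_prop
  have hint : Integrable (fun θ => ‖∑ k ∈ Finset.range n, a k * circleMap 0 1 θ ^ k‖ ^ 2)
      angleMeasure := by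
    refine Integrable.of_bound (hcont.norm.pow 2).aestronglyMeasurable
      ((∑ k ∈ Finset.range n, ‖a k‖) ^ 2) (.of_forall fun θ => ?_)
    rw [norm_pow, norm_norm]
    refine pow_le_pow_left₀ (norm_nonneg _) ((norm_sum_le _ _).trans_eq ?_) 2
    simp
  have h3 := ofReal_integral_eq_lintegral_ofReal hint (.of_forall fun θ => by positivity)
  rw [← h1, ENNReal.ofReal_sum_of_nonneg fun k _ => by positivity] at h3
  simpa only [ENNReal.ofReal_pow (norm_nonneg _), ofReal_norm] using h3.symm

/-- **Parseval's identity** for absolutely convergent power series on the unit circle. -/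
theorem lintegral_sq_tsum_mul_circleMap_pow {a : ℕ → ℂ} (ha : Summable fun k => ‖a k‖) :
    ∫⁻ θ, ‖∑' k, a k * circleMap 0 1 θ ^ k‖ₑ ^ 2 ∂angleMeasure = ∑' k, ‖a k‖ₑ ^ 2 := by
  have hn : ∀ θ k, ‖a k * circleMap 0 1 θ ^ k‖ = ‖a k‖ := fun θ k => by simp
  have hs : ∀ θ, Summable fun k => a k * circleMap 0 1 θ ^ k := fun θ =>
    Summable.of_norm (by simpa only [hn] using ha)
  have h1 : Tendsto (fun n => ∫⁻ θ, ‖∑ k ∈ Finset.range n, a k * circleMap 0 1 θ ^ k‖ₑ ^ 2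
      ∂angleMeasure) atTop
      (𝓝 (∫⁻ θ, ‖∑' k, a k * circleMap 0 1 θ ^ k‖ₑ ^ 2 ∂angleMeasure)) := by
    refine tendsto_lintegral_of_dominated_convergence
      (fun _ => ENNReal.ofReal (∑' k, ‖a k‖) ^ 2) (fun n => ?_) (fun n => .of_forall fun θ => ?_)
      ?_ (.of_forall fun θ => ?_)
    · have := continuous_circleMap 0 1
      exact Continuous.measurable (by fun_prop)
    · dsimp only
      refine pow_le_pow_left' ?_ 2
      rw [← ofReal_norm]
      refine ENNReal.ofReal_le_ofReal ((norm_sum_le _ _).trans ?_)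
      simp only [hn]
      exact ha.sum_le_tsum _ fun k _ => norm_nonneg _
    · rw [lintegral_const, measure_univ, mul_one]
      exact ENNReal.pow_ne_top ENNReal.ofReal_ne_top
    · exact ENNReal.Tendsto.pow (hs θ).hasSum.tendsto_sum_nat.enorm
  simp only [lintegral_sq_sum_mul_circleMap_pow] at h1
  exact tendsto_nhds_unique h1 (ENNReal.tendsto_nat_tsum _)

/-! ### Zero-free majorants -/

/-- Trigonometric polynomials are uniformly dense in the continuous functions on the circle. Each
equals `A + conj B` there with `A`, `B` entire, and its real part is that of the entire function `A
+ B`. -/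
theorem exists_differentiable_re_near {φ : ℂ → ℝ} (hφ : ContinuousOn φ (Metric.sphere 0 1))
    {ε : ℝ} (hε : 0 < ε) : ∃ H : ℂ → ℂ, Differentiable ℂ H ∧
      ∀ θ : ℝ, |(H (circleMap 0 1 θ)).re - φ (circleMap 0 1 θ)| < ε := by
  have : Fact (0 < 2 * Real.pi) := ⟨Real.two_pi_pos⟩
  have hcircle : ∀ θ : ℝ, (AddCircle.toCircle (T := 2 * Real.pi) θ : ℂ) = circleMap 0 1 θ := by
    intro θ
    rw [AddCircle.toCircle_apply_mk, Circle.coe_exp, circleMap_zero,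
      div_self Real.two_pi_pos.ne']
    simp
  let ψ : C(AddCircle (2 * Real.pi), ℂ) :=
    ⟨fun t => (φ (AddCircle.toCircle t) : ℂ), Complex.continuous_ofReal.comp
      (hφ.comp_continuous (by fun_prop)
        fun t => mem_sphere_zero_iff_norm.2 (Circle.norm_coe _))⟩
  have hψ : ψ ∈ (Submodule.span ℂ (range <| @fourier (2 * Real.pi))).topologicalClosure := by
    rw [span_fourier_closure_eq_top]
    trivial
  obtain ⟨q, hq, hqψ⟩ := Metric.mem_closure_iff.1 hψ ε hε
  have hrep : ∃ A B : ℂ → ℂ, Differentiable ℂ A ∧ Differentiable ℂ B ∧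
      ∀ θ : ℝ, q θ = A (circleMap 0 1 θ) + (starRingEnd ℂ) (B (circleMap 0 1 θ)) := by
    clear hqψ
    refine Submodule.span_induction ?_ ?_ ?_ ?_ hq
    · rintro _ ⟨n, rfl⟩
      have hpow : ∀ (m : ℕ) (θ : ℝ), fourier (T := 2 * Real.pi) (m : ℤ) θ = circleMap 0 1 θ ^ m := by
        intro m θ
        rw [fourier_apply, natCast_zsmul, AddCircle.toCircle_nsmul, Circle.coe_pow, hcircle]
      obtain ⟨m, rfl | rfl⟩ := n.eq_nat_or_neg
      · exact ⟨fun z => z ^ m, 0, differentiable_pow m, differentiable_const 0,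
          fun θ => by simp [hpow]⟩
      · exact ⟨0, fun z => z ^ m, differentiable_const 0, differentiable_pow m,
          fun θ => by rw [fourier_neg, hpow]; simp⟩
    · exact ⟨0, 0, differentiable_const 0, differentiable_const 0, fun θ => by simp⟩
    · rintro x y - - ⟨A, B, hA, hB, h⟩ ⟨A', B', hA', hB', h'⟩
      exact ⟨A + A', B + B', hA.add hA', hB.add hB', fun θ => by
        rw [ContinuousMap.add_apply, h, h', Pi.add_apply, Pi.add_apply, map_add]; ring⟩
    · rintro c x - ⟨A, B, hA, hB, h⟩
      exact ⟨c • A, (starRingEnd ℂ c) • B, hA.const_smul c, hB.const_smul _, fun θ => by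
        rw [ContinuousMap.smul_apply, h]; simp [mul_add]⟩
  obtain ⟨A, B, hA, hB, hAB⟩ := hrep
  refine ⟨A + B, hA.add hB, fun θ => ?_⟩
  have h1 : dist (ψ θ) (q θ) < ε := (ContinuousMap.dist_apply_le_dist _).trans_lt hqψ
  rw [hAB, dist_comm, dist_eq_norm] at h1
  refine lt_of_eq_of_lt ?_ ((Complex.abs_re_le_norm _).trans_lt h1)
  simp [ψ, hcircle]

/-- A function analytic on the disk and continuous up to the boundary is dominated by the
exponential of an entire function, which is not much larger on the circle. -/
theorem exists_norm_le_exp_re {f : ℂ → ℂ} (hf : DiffContOnCl ℂ f (Metric.ball 0 1)) :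
    ∃ H : ℂ → ℂ, Differentiable ℂ H ∧
      (∀ z ∈ Metric.closedBall (0 : ℂ) 1, ‖f z‖ ≤ Real.exp (H z).re) ∧
      ∀ θ : ℝ, Real.exp (H (circleMap 0 1 θ)).re ≤ Real.exp 1 * (‖f (circleMap 0 1 θ)‖ + 1) := by
  have hcl : closure (Metric.ball (0 : ℂ) 1) = Metric.closedBall 0 1 := closure_ball 0 one_ne_zero
  have hfc : ContinuousOn f (Metric.closedBall 0 1) := hcl ▸ hf.continuousOn
  -- Adding 1 keeps the logarithm continuous at zeros of `f`. The shift by `1 / 2`, equal to the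
  -- approximation error, puts `Re H` between `log (|f| + 1)` and that quantity plus 1.
  have hφ : ContinuousOn (fun z => Real.log (‖f z‖ + 1) + 1 / 2) (Metric.sphere 0 1) :=
    (((hfc.mono Metric.sphere_subset_closedBall).norm.add continuousOn_const).log
      fun z _ => (by positivity : ‖f z‖ + 1 ≠ 0)).add continuousOn_const
  obtain ⟨H, hH, hHφ⟩ := exists_differentiable_re_near hφ (ε := 1 / 2) (by norm_num)
  refine ⟨H, hH, fun z hz => ?_, fun θ => ?_⟩
  -- The bound on the circle extends inside by the maximum modulus principle for `exp (-H) * f`.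
  · have hd : DiffContOnCl ℂ (fun z => Complex.exp (-H z) * f z) (Metric.ball 0 1) :=
      (hH.neg.cexp.diffContOnCl).smul hf
    have h1 := Complex.norm_le_of_forall_mem_frontier_norm_le Metric.isBounded_ball hd (C := 1) ?_
      (z := z) (hcl ▸ hz)
    · rw [norm_mul, Complex.norm_exp, Complex.neg_re, Real.exp_neg] at h1
      rwa [inv_mul_le_iff₀ (Real.exp_pos _), mul_one] at h1
    · intro w hw
      rw [frontier_ball _ one_ne_zero] at hw
      obtain ⟨θ, rfl⟩ : ∃ θ, circleMap 0 1 θ = w := by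
        have : w ∈ range (circleMap 0 1) := by rw [range_circleMap]; simpa using hw
        exact this
      have h2 := (abs_lt.1 (hHφ θ)).1
      rw [norm_mul, Complex.norm_exp, Complex.neg_re, Real.exp_neg,
        inv_mul_le_iff₀ (Real.exp_pos _), mul_one]
      have h3 : Real.log (‖f (circleMap 0 1 θ)‖ + 1) ≤ (H (circleMap 0 1 θ)).re := by linarith
      have h4 := Real.exp_le_exp.2 h3
      rw [Real.exp_log (by positivity)] at h4
      linarith
  · have h2 := (abs_lt.1 (hHφ θ)).2
    have h3 : (H (circleMap 0 1 θ)).re ≤ 1 + Real.log (‖f (circleMap 0 1 θ)‖ + 1) := by linarith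
    have h4 := Real.exp_le_exp.2 h3
    rwa [Real.exp_add, Real.exp_log (by positivity)] at h4

/-! ### Square integrable majorants of functions in Hardy spaces -/

/-- Absolute summability of the Taylor coefficients is convergence of the Taylor series at `z = 1`.
-/
theorem exists_summable_eq_tsum_of_differentiable {F : ℂ → ℂ} (hF : Differentiable ℂ F) :
    ∃ a : ℕ → ℂ, (Summable fun k => ‖a k‖) ∧ ∀ z, F z = ∑' k, a k * z ^ k := by
  have h := fun z => Complex.hasSum_taylorSeries_of_entire hF 0 z
  refine ⟨fun k => (k.factorial : ℂ)⁻¹ * iteratedDeriv k F 0, ?_, fun z => ?_⟩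
  · have h1 := (h 1).summable.norm
    simpa using h1
  · rw [← (h z).tsum_eq]
    refine tsum_congr fun k => ?_
    simp only [sub_zero, smul_eq_mul]
    ring

/-- The dilate of `f` is continuous up to the circle, so `exists_norm_le_exp_re` gives `H`, and `exp
(p H / 2)` has squared modulus `exp (Re H) ^ p`. Parseval bounds its coefficients by the `L^p` mean
of `e (|f| + 1)`, hence independently of `r`, which allows `r → 1`. -/
theorem exists_series_majorant_of_lt {p : ℝ≥0∞} (hp : 1 ≤ p) (hpt : p ≠ ∞) {f : Disc → ℂ}
    (hf : IsHolomorphic f) {r : ℝ} (hr : r ∈ Ico (0 : ℝ) 1) :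
    ∃ a : ℕ → ℂ, (∀ z : ℂ, ‖z‖ ≤ 1 →
        ‖discExt f (r * z)‖ ^ p.toReal ≤ ‖∑' k, a k * z ^ k‖ ^ 2) ∧
      ∑' k, ‖a k‖ₑ ^ 2 ≤ (ENNReal.ofReal (Real.exp 1) * (hardyENorm p f + 1)) ^ p.toReal := by
  have hp0 : p ≠ 0 := (zero_lt_one.trans_le hp).ne'
  have hq : 0 < p.toReal := ENNReal.toReal_pos hp0 hpt
  have hmaps : ∀ z ∈ Metric.closedBall (0 : ℂ) 1, (r : ℂ) * z ∈ Metric.ball (0 : ℂ) 1 := by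
    intro z hz
    rw [mem_closedBall_zero_iff] at hz
    rw [mem_ball_zero_iff, norm_mul, Complex.norm_real, Real.norm_of_nonneg hr.1]
    exact (mul_le_of_le_one_right hr.1 hz).trans_lt hr.2
  have hd : DiffContOnCl ℂ (fun z => discExt f (r * z)) (Metric.ball 0 1) := by
    have h1 : DifferentiableOn ℂ (fun z => discExt f (r * z)) (Metric.closedBall 0 1) :=
      DifferentiableOn.comp hf (differentiableOn_id.const_mul _) hmaps
    exact h1.diffContOnCl_ball Subset.rfl
  obtain ⟨H, hH, hle, hge⟩ := exists_norm_le_exp_re hd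
  obtain ⟨a, ha, hFa⟩ := exists_summable_eq_tsum_of_differentiable
    (F := fun z => Complex.exp ((p.toReal / 2 : ℝ) * H z)) (hH.const_mul _).cexp
  have hF : ∀ z, ‖∑' k, a k * z ^ k‖ ^ 2 = Real.exp (H z).re ^ p.toReal := by
    intro z
    rw [← hFa, Complex.norm_exp, Complex.re_ofReal_mul, ← Real.exp_nat_mul, ← Real.exp_mul]
    congr 1
    push_cast
    ring
  refine ⟨a, fun z hz => ?_, ?_⟩
  · rw [hF]
    exact Real.rpow_le_rpow (norm_nonneg _) (hle z (mem_closedBall_zero_iff.2 hz)) hq.le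
  · rw [← lintegral_sq_tsum_mul_circleMap_pow ha]
    have hcircle : ∀ θ, (r : ℂ) * circleMap 0 1 θ = circleMap 0 r θ := by
      intro θ
      simp [circleMap]
    have h1 : ∀ θ, ‖∑' k, a k * circleMap 0 1 θ ^ k‖ₑ ^ 2 ≤
        ‖Real.exp 1 * (‖discExt f (circleMap 0 r θ)‖ + 1)‖ₑ ^ p.toReal := by
      intro θ
      rw [← ofReal_norm, ← ENNReal.ofReal_pow (norm_nonneg _), hF,
        ← ENNReal.ofReal_rpow_of_nonneg (Real.exp_pos _).le hq.le]
      refine ENNReal.rpow_le_rpow ?_ hq.le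
      rw [Real.enorm_of_nonneg (by positivity)]
      refine ENNReal.ofReal_le_ofReal ?_
      simpa only [hcircle] using hge θ
    refine (lintegral_mono h1).trans ?_
    have h2 := eLpNorm_eq_lintegral_rpow_enorm_toReal hp0 hpt (μ := angleMeasure)
      (f := fun θ => Real.exp 1 * (‖discExt f (circleMap 0 r θ)‖ + 1))
    have h3 : (∫⁻ θ, ‖Real.exp 1 * (‖discExt f (circleMap 0 r θ)‖ + 1)‖ₑ ^ p.toReal
        ∂angleMeasure) = eLpNorm (fun θ => Real.exp 1 * (‖discExt f (circleMap 0 r θ)‖ + 1)) p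
          angleMeasure ^ p.toReal := by
      rw [h2, ← ENNReal.rpow_mul, one_div, inv_mul_cancel₀ hq.ne', ENNReal.rpow_one]
    rw [h3]
    refine ENNReal.rpow_le_rpow ?_ hq.le
    refine (eLpNorm_const_smul_le (c := Real.exp 1)
      (f := fun θ => ‖discExt f (circleMap 0 r θ)‖ + 1)).trans ?_
    rw [Real.enorm_of_nonneg (Real.exp_pos _).le]
    refine mul_le_mul_right ?_ _
    refine (eLpNorm_add_le (f := fun θ => ‖discExt f (circleMap 0 r θ)‖) (g := fun _ => (1 : ℝ))
      (continuous_circle hf hr).norm.aestronglyMeasurable aestronglyMeasurable_const hp).trans ?_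
    refine add_le_add ?_ ?_
    · rw [eLpNorm_norm]
      exact le_iSup₂ (f := fun r _ => circleMean p r f) r hr
    · rw [eLpNorm_const _ hp0 (IsProbabilityMeasure.ne_zero _)]
      simp

/-- A function `f` in `H^p` has a majorant `|f|^p ≤ |F|²` with `F` in `H²`. -/
theorem exists_series_majorant {p : ℝ≥0∞} (hp : 1 ≤ p) (hpt : p ≠ ∞) {f : Disc → ℂ}
    (hf : IsHolomorphic f) (hfN : hardyENorm p f < ∞) :
    ∃ c : ℕ → ℂ, ∑' k, ‖c k‖ₑ ^ 2 ≠ ∞ ∧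
      ∀ z : Disc, ‖f z‖ ^ p.toReal ≤ ‖∑' k, c k * (z : ℂ) ^ k‖ ^ 2 := by
  have hq : 0 < p.toReal := ENNReal.toReal_pos (zero_lt_one.trans_le hp).ne' hpt
  set K := (ENNReal.ofReal (Real.exp 1) * (hardyENorm p f + 1)) ^ p.toReal with hK
  have hKt : K ≠ ∞ := ENNReal.rpow_ne_top_of_nonneg hq.le (ENNReal.mul_ne_top
    ENNReal.ofReal_ne_top (ENNReal.add_ne_top.2 ⟨hfN.ne, ENNReal.one_ne_top⟩))
  obtain ⟨r, -, hr, hrlim⟩ := exists_seq_strictMono_tendsto' (show (0 : ℝ) < 1 from one_pos)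
  choose a hle hsum using fun n =>
    exists_series_majorant_of_lt hp hpt hf ⟨(hr n).1.le, (hr n).2⟩
  have hb : ∀ n k, ‖a n k‖ ≤ √K.toReal := by
    intro n k
    have h1 := (ENNReal.le_tsum k).trans (hsum n)
    refine Real.le_sqrt_of_sq_le ?_
    have h2 := ENNReal.toReal_mono hKt h1
    simpa using h2
  -- The coefficients stay in a fixed compact disk, so all of them converge along one ultrafilter
  -- finer than `atTop`; this replaces a diagonal subsequence.
  let U : Ultrafilter ℕ := hyperfilter ℕ
  have hU : (U : Filter ℕ) ≤ atTop := Nat.hyperfilter_le_atTop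
  have hlim : ∀ k, ∃ x, Tendsto (fun n => a n k) U (𝓝 x) := by
    intro k
    obtain ⟨x, -, hx⟩ := (isCompact_closedBall (0 : ℂ) (√K.toReal)).ultrafilter_le_nhds
      (U.map fun n => a n k) (by
        rw [Ultrafilter.coe_map, le_principal_iff]
        exact Filter.mem_map.2 (univ_mem' fun n => mem_closedBall_zero_iff.2 (hb n k)))
    exact ⟨x, hx⟩
  choose c hc using hlim
  refine ⟨c, ne_top_of_le_ne_top hKt (ENNReal.tsum_le_of_sum_range_le fun n => ?_), fun z => ?_⟩
  · have h1 : Tendsto (fun m => ∑ k ∈ Finset.range n, ‖a m k‖ₑ ^ 2) U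
        (𝓝 (∑ k ∈ Finset.range n, ‖c k‖ₑ ^ 2)) :=
      tendsto_finsetSum _ fun k _ => ENNReal.Tendsto.pow (hc k).enorm
    exact le_of_tendsto h1 (.of_forall fun m => (ENNReal.sum_le_tsum _).trans (hsum m))
  · have hz1 : ‖(z : ℂ)‖ < 1 := mem_ball_zero_iff.1 z.2
    have h1 : Tendsto (fun n => ∑' k, a n k * (z : ℂ) ^ k) U (𝓝 (∑' k, c k * (z : ℂ) ^ k)) := by
      -- At a fixed point of the open disk, the uniform coefficient bound gives a geometric
      -- majorant.
      refine tendsto_tsum_of_dominated_convergence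
        (bound := fun k => √K.toReal * ‖(z : ℂ)‖ ^ k)
        ((summable_geometric_of_lt_one (norm_nonneg _) hz1).mul_left _)
        (fun k => (hc k).mul_const _) (.of_forall fun n k => ?_)
      rw [norm_mul, norm_pow]
      exact mul_le_mul_of_nonneg_right (hb n k) (by positivity)
    have h2 : Tendsto (fun n => discExt f (r n * z)) U (𝓝 (f z)) := by
      have h3 : ContinuousAt (discExt f) z :=
        (hf.differentiableAt (Metric.isOpen_ball.mem_nhds z.2)).continuousAt
      have h4 : Tendsto (fun n => (r n : ℂ) * z) atTop (𝓝 z) := by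
        have := ((Complex.continuous_ofReal.tendsto 1).comp hrlim).mul_const (z : ℂ)
        simpa using this
      have h5 := h3.tendsto.comp (h4.mono_left hU)
      rwa [discExt_coe] at h5
    exact le_of_tendsto_of_tendsto ((h2.norm).rpow_const (Or.inr hq.le)) (h1.norm.pow 2)
      (.of_forall fun n => hle n z hz1.le)

/-- Multiplication by bounded analytic functions in Hardy spaces, up to a small remainder. -/
theorem hardyENorm_mul_rpow_le {p : ℝ≥0∞} (hp : 1 ≤ p) (hpt : p ≠ ∞) {f g : Disc → ℂ}
    {B : ℝ} {c : ℕ → ℂ} (hc : ∑' k, ‖c k‖ₑ ^ 2 ≠ ∞)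
    (hfc : ∀ z : Disc, ‖f z‖ ^ p.toReal ≤ ‖∑' k, c k * (z : ℂ) ^ k‖ ^ 2) (hg : IsHolomorphic g)
    (hgB : ∀ z, ‖g z‖ ≤ B) (n : ℕ) :
    hardyENorm p (g * f) ^ p.toReal ≤
      2 * (∑ k ∈ Finset.range n, ‖c k‖ₑ) ^ 2 * hardyENorm p g ^ p.toReal +
        2 * ENNReal.ofReal B ^ p.toReal * ∑' k, ‖c (k + n)‖ₑ ^ 2 := by
  have hp0 : p ≠ 0 := (zero_lt_one.trans_le hp).ne'
  have hq : 0 < p.toReal := ENNReal.toReal_pos hp0 hpt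
  have hcb : ∃ D, ∀ k, ‖c k‖ ≤ D := by
    refine ⟨√(∑' k, ‖c k‖ₑ ^ 2).toReal, fun k => Real.le_sqrt_of_sq_le ?_⟩
    have h2 := ENNReal.toReal_mono hc (ENNReal.le_tsum (f := fun k => ‖c k‖ₑ ^ 2) k)
    simpa using h2
  obtain ⟨D, hD⟩ := hcb
  have hsum : ∀ (m : ℕ) (z : ℂ), ‖z‖ < 1 → Summable fun k => ‖c (k + m) * z ^ k‖ := by
    intro m z hz
    refine ((summable_geometric_of_lt_one (norm_nonneg _) hz).mul_left D).of_nonneg_of_le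
      (fun k => norm_nonneg _) fun k => ?_
    rw [norm_mul, norm_pow]
    exact mul_le_mul_of_nonneg_right (hD _) (by positivity)
  -- The factor `z ^ n` is pulled out of the tail and bounded by 1; the factors 2 come from `(x +
  -- y)² ≤ 2x² + 2y²`.
  have hsplit : ∀ z : ℂ, ‖z‖ < 1 → ‖∑' k, c k * z ^ k‖ₑ ^ 2 ≤
      2 * (∑ k ∈ Finset.range n, ‖c k‖ₑ) ^ 2 + 2 * ‖∑' k, c (k + n) * z ^ k‖ₑ ^ 2 := by
    intro z hz
    have h1 : ∑' k, c k * z ^ k =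
        ∑ k ∈ Finset.range n, c k * z ^ k + z ^ n * ∑' k, c (k + n) * z ^ k := by
      have hs0 : Summable fun k => c k * z ^ k := (hsum 0 z hz).of_norm
      rw [← hs0.sum_add_tsum_nat_add n, ← tsum_mul_left]
      refine congrArg₂ _ rfl (tsum_congr fun k => ?_)
      rw [pow_add]
      ring
    have hz1 : ∀ k, ‖z ^ k‖ ≤ 1 := fun k => by
      rw [norm_pow]
      exact pow_le_one₀ (norm_nonneg _) hz.le
    have h2 : ‖∑' k, c k * z ^ k‖ ≤
        ∑ k ∈ Finset.range n, ‖c k‖ + ‖∑' k, c (k + n) * z ^ k‖ := by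
      rw [h1]
      refine (norm_add_le _ _).trans (add_le_add ((norm_sum_le _ _).trans
        (Finset.sum_le_sum fun k _ => ?_)) ?_)
      · rw [norm_mul]
        exact mul_le_of_le_one_right (norm_nonneg _) (hz1 k)
      · rw [norm_mul]
        exact mul_le_of_le_one_left (norm_nonneg _) (hz1 n)
    have h3 : ‖∑' k, c k * z ^ k‖ ^ 2 ≤
        2 * (∑ k ∈ Finset.range n, ‖c k‖) ^ 2 + 2 * ‖∑' k, c (k + n) * z ^ k‖ ^ 2 :=
      (pow_le_pow_left₀ (norm_nonneg _) h2 2).trans (add_sq_le.trans_eq (by ring))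
    have h4 := ENNReal.ofReal_le_ofReal h3
    have hS : 0 ≤ ∑ k ∈ Finset.range n, ‖c k‖ := Finset.sum_nonneg fun k _ => norm_nonneg _
    rw [ENNReal.ofReal_add (by positivity) (by positivity), ENNReal.ofReal_mul zero_le_two,
      ENNReal.ofReal_mul zero_le_two, ENNReal.ofReal_pow hS,
      ENNReal.ofReal_sum_of_nonneg fun k _ => norm_nonneg _] at h4
    simpa only [ENNReal.ofReal_pow (norm_nonneg _), ofReal_norm, ENNReal.ofReal_ofNat] using h4
  rw [← ENNReal.le_rpow_inv_iff hq]
  refine iSup₂_le fun r hr => ?_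
  rw [ENNReal.le_rpow_inv_iff hq]
  have hmean : ∀ h : Disc → ℂ, circleMean p r h ^ p.toReal =
      ∫⁻ θ, ‖discExt h (circleMap 0 r θ)‖ₑ ^ p.toReal ∂angleMeasure := by
    intro h
    rw [circleMean, eLpNorm_eq_lintegral_rpow_enorm_toReal hp0 hpt, ← ENNReal.rpow_mul, one_div,
      inv_mul_cancel₀ hq.ne', ENNReal.rpow_one]
  have hnorm : ∀ θ, ‖circleMap 0 r θ‖ < 1 := fun θ => by
    rw [norm_circleMap_zero, abs_of_nonneg hr.1]
    exact hr.2
  -- `|g|^p` is kept on the polynomial part and replaced by `B^p` on the tail only. The radius is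
  -- absorbed into the coefficients so that Parseval applies on the unit circle; `r ^ k ≤ 1` then
  -- makes the bound uniform in `r`.
  have hpt : ∀ θ, ‖discExt (g * f) (circleMap 0 r θ)‖ₑ ^ p.toReal ≤
      2 * (∑ k ∈ Finset.range n, ‖c k‖ₑ) ^ 2 * ‖discExt g (circleMap 0 r θ)‖ₑ ^ p.toReal +
      2 * ENNReal.ofReal B ^ p.toReal *
        ‖∑' k, (c (k + n) * (r : ℂ) ^ k) * circleMap 0 1 θ ^ k‖ₑ ^ 2 := by
    intro θ
    have hz : circleMap 0 r θ ∈ Metric.ball (0 : ℂ) 1 := mem_ball_zero_iff.2 (hnorm θ)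
    have h1 : ∀ k : ℕ, (c (k + n) * (r : ℂ) ^ k) * circleMap 0 1 θ ^ k =
        c (k + n) * circleMap 0 r θ ^ k := by
      intro k
      rw [mul_assoc, ← mul_pow]
      simp [circleMap]
    have h2 : ‖f ⟨_, hz⟩‖ₑ ^ p.toReal ≤ ‖∑' k, c k * circleMap 0 r θ ^ k‖ₑ ^ 2 := by
      have h3 := ENNReal.ofReal_le_ofReal (hfc ⟨_, hz⟩)
      rwa [← ENNReal.ofReal_rpow_of_nonneg (norm_nonneg _) hq.le,
        ENNReal.ofReal_pow (norm_nonneg _), ofReal_norm, ofReal_norm] at h3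
    have h4 : ‖g ⟨_, hz⟩‖ₑ ^ p.toReal ≤ ENNReal.ofReal B ^ p.toReal := by
      refine ENNReal.rpow_le_rpow ?_ hq.le
      rw [← ofReal_norm]
      exact ENNReal.ofReal_le_ofReal (hgB _)
    simp only [h1, discExt_of_mem _ hz, Pi.mul_apply, enorm_mul]
    rw [ENNReal.mul_rpow_of_nonneg _ _ hq.le]
    calc ‖g ⟨_, hz⟩‖ₑ ^ p.toReal * ‖f ⟨_, hz⟩‖ₑ ^ p.toReal
        ≤ ‖g ⟨_, hz⟩‖ₑ ^ p.toReal * (2 * (∑ k ∈ Finset.range n, ‖c k‖ₑ) ^ 2 +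
          2 * ‖∑' k, c (k + n) * circleMap 0 r θ ^ k‖ₑ ^ 2) :=
          mul_le_mul_right (h2.trans (hsplit _ (hnorm θ))) _
      _ = 2 * (∑ k ∈ Finset.range n, ‖c k‖ₑ) ^ 2 * ‖g ⟨_, hz⟩‖ₑ ^ p.toReal +
          2 * ‖g ⟨_, hz⟩‖ₑ ^ p.toReal * ‖∑' k, c (k + n) * circleMap 0 r θ ^ k‖ₑ ^ 2 := by ring
      _ ≤ _ := by gcongr
  have hC1 : 2 * (∑ k ∈ Finset.range n, ‖c k‖ₑ) ^ 2 ≠ ∞ := by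
    refine ENNReal.mul_ne_top ENNReal.ofNat_ne_top (ENNReal.pow_ne_top ?_)
    exact ENNReal.sum_ne_top.2 fun k _ => enorm_ne_top
  have hC2 : 2 * ENNReal.ofReal B ^ p.toReal ≠ ∞ :=
    ENNReal.mul_ne_top ENNReal.ofNat_ne_top
      (ENNReal.rpow_ne_top_of_nonneg hq.le ENNReal.ofReal_ne_top)
  have hsummable : Summable fun k => ‖c (k + n) * (r : ℂ) ^ k‖ :=
    hsum n r (by rw [Complex.norm_real, Real.norm_of_nonneg hr.1]; exact hr.2)
  rw [hmean]
  refine (lintegral_mono hpt).trans ?_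
  rw [lintegral_add_left' ((((continuous_circle hg hr).measurable.enorm).pow_const
    _).const_mul _).aemeasurable, lintegral_const_mul' _ _ hC1, lintegral_const_mul' _ _ hC2,
    ← hmean, lintegral_sq_tsum_mul_circleMap_pow hsummable]
  refine add_le_add (mul_le_mul_right (ENNReal.rpow_le_rpow
    (le_iSup₂ (f := fun r _ => circleMean p r g) r hr) hq.le) _)
    (mul_le_mul_right (ENNReal.tsum_le_tsum fun k => pow_le_pow_left' ?_ 2) _)
  rw [enorm_mul]
  refine mul_le_of_le_one_right' ?_
  rw [enorm_pow, ← ofReal_norm, Complex.norm_real, Real.norm_of_nonneg hr.1]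
  exact pow_le_one' (ENNReal.ofReal_le_one.2 hr.2.le) k

/-- The cut-off `n` is chosen first, making the tail term at most `ε ^ p / 2` through the bound `B`
alone, uniformly in `t`; with `n` fixed, the polynomial term tends to 0 with the norm of `G t`. -/
theorem hardyENorm_mul_tendsto {p : ℝ≥0∞} (hp : 1 ≤ p) (hpt : p ≠ ∞)
    {f : Disc → ℂ} (hf : IsHolomorphic f) (hfN : hardyENorm p f < ∞) (B t₀ : ℝ)
    (G : ℝ → Disc → ℂ) (hG : ∀ t, IsHolomorphic (G t)) (hB : ∀ᶠ t in 𝓝 t₀, ∀ z, ‖G t z‖ ≤ B)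
    (hN : Tendsto (fun t => hardyENorm p (G t)) (𝓝 t₀) (𝓝 0)) :
    Tendsto (fun t => hardyENorm p (G t * f)) (𝓝 t₀) (𝓝 0) := by
  have hq : 0 < p.toReal := ENNReal.toReal_pos (zero_lt_one.trans_le hp).ne' hpt
  obtain ⟨c, hc, hfc⟩ := exists_series_majorant hp hpt hf hfN
  rw [ENNReal.tendsto_nhds_zero]
  intro ε hε
  have hδ : 0 < ε ^ p.toReal / 2 :=
    ENNReal.half_pos (ENNReal.rpow_pos_of_nonneg hε hq.le).ne'
  have htail : Tendsto (fun n => 2 * ENNReal.ofReal B ^ p.toReal * ∑' k, ‖c (k + n)‖ₑ ^ 2) atTop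
      (𝓝 0) := by
    have := ENNReal.Tendsto.const_mul (a := 2 * ENNReal.ofReal B ^ p.toReal)
      (ENNReal.tendsto_sum_nat_add (fun k => ‖c k‖ₑ ^ 2) hc)
      (Or.inr (ENNReal.mul_ne_top ENNReal.ofNat_ne_top
        (ENNReal.rpow_ne_top_of_nonneg hq.le ENNReal.ofReal_ne_top)))
    rwa [mul_zero] at this
  obtain ⟨n, hn⟩ := (htail.eventually (ge_mem_nhds hδ)).exists
  have hmain : Tendsto (fun t => 2 * (∑ k ∈ Finset.range n, ‖c k‖ₑ) ^ 2 *
      hardyENorm p (G t) ^ p.toReal) (𝓝 t₀) (𝓝 0) := by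
    have h1 := hN.ennrpow_const p.toReal
    rw [ENNReal.zero_rpow_of_pos hq] at h1
    have := ENNReal.Tendsto.const_mul (a := 2 * (∑ k ∈ Finset.range n, ‖c k‖ₑ) ^ 2) h1
      (Or.inr (ENNReal.mul_ne_top ENNReal.ofNat_ne_top (ENNReal.pow_ne_top
        (ENNReal.sum_ne_top.2 fun k _ => enorm_ne_top))))
    rwa [mul_zero] at this
  filter_upwards [hB, hmain.eventually (ge_mem_nhds hδ)] with t ht1 ht2
  rw [← ENNReal.rpow_le_rpow_iff hq]
  refine (hardyENorm_mul_rpow_le hp hpt hc hfc (hG t) ht1 n).trans ?_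
  exact (add_le_add ht2 hn).trans_eq (ENNReal.add_halves _)

theorem isAnalyticSpace_hardy {p : ℝ≥0∞} [hp : Fact (1 ≤ p)] (hpt : p ≠ ∞) :
    IsAnalyticSpace (X := Hardy p) (hardySubmodule p).subtype (hardyENorm p)
      (Hardy.mulOp p) where
  holomorphic x := x.2.1
  norm_eq x := (ENNReal.ofReal_toReal x.2.2.ne).symm
  exists_eq f hf hN := ⟨⟨f, hf, hN⟩, rfl⟩
  one_lt_top := hardyENorm_one_lt_top p
  ev_mul _ _ := rfl
  mul_le := hardyENorm_mul_le p
  le_liminf _ _ := hardyENorm_le_liminf p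
  point_le _ hR := hardy_point_le hp.out hR
  mul_tendsto _ hf hN := hardyENorm_mul_tendsto hp.out hpt hf hN

theorem mainTheorem3 (p : ℝ≥0∞) [Fact (1 ≤ p)] (hp : p ≠ ∞) (g : ℝ → HInfty) :
    ((SatisfiesW (fun t => Hardy.mulOp p (g t)) ↔
        SymbolsContinuous (hardyENorm p) g ∧ SymbolsLocallyBounded g ∧ SymbolsIntegrable g) ∧
      (SymbolsContinuous (hardyENorm p) g ∧ SymbolsLocallyBounded g ∧ SymbolsIntegrable g →
        SatisfiesPointwiseW (fun t => Hardy.mulOp p (g t))) ∧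
      (SatisfiesPointwiseW (fun t => Hardy.mulOp p (g t)) →
        SymbolsContinuous (hardyENorm p) g ∧ SymbolsLocallyBounded g)) ∧
    ∀ (α : ℝ) [Fact (-1 < α)],
      (SatisfiesW (fun t => Bergman.mulOp p α (g t)) ↔
        SymbolsContinuous (bergmanENorm p α) g ∧ SymbolsLocallyBounded g ∧ SymbolsIntegrable g) ∧
      (SymbolsContinuous (bergmanENorm p α) g ∧ SymbolsLocallyBounded g ∧ SymbolsIntegrable g →
        SatisfiesPointwiseW (fun t => Bergman.mulOp p α (g t))) ∧
      (SatisfiesPointwiseW (fun t => Bergman.mulOp p α (g t)) →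
        SymbolsContinuous (bergmanENorm p α) g ∧ SymbolsLocallyBounded g) :=
  ⟨(isAnalyticSpace_hardy hp).main g, fun _ _ => (isAnalyticSpace_bergman hp).main g⟩
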